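/- **Setting.** Let $\mathbb K$ be a field, $\underline s=s_1,\dots,s_m$, $\underline x=x_1,\dots,x_n$ with $m,n\ge1$, and let $\underline F=F_1,\dots,F_\rho\in\mathbb K[\![\underline s,\underline x]\!]\langle\underline\partial\rangle$ (polynomial in $\underline\partial=\partial_{x_1},\dots,\partial_{x_n}$) be such that $\underline f=\underline F(\underline s=\underline 0)\in\mathbb K[\![\underline x]\!]^\rho$ does not involve $\underline\partial$ and $\langle\underline x\rangle^k\subset\langle\underline f\rangle\mathbb K[\![\underline x]\!]$ for some $k\ge0$. Fix a nonzero matrix $D=(\underline d^j)_j\in\mathbb K[\![\underline s,\underline x]\!]\langle\underline\partial\rangle^{m\times\rho}$ with $\underline F=\underline f-\underline sD$. Let $<_{\underline x}$ and $<_{\underline s}$ be local degree orderings on the monomials in $\underline x$ and in $\underline s$ with weighted degrees $\deg_{\underline x},\deg_{\underline s}$ (additive, rational, negative on every variable; the orderings are total, multiplicative, and refine the degrees). Let $<\,=(<_{\underline s},<_{\underline x})$ be the block ordering on the monomials $\underline s^{\underline\alpha}\underline x^{\underline\beta}$ (compare $\underline\alpha$ first), and $\deg=\deg_{\underline s}+\deg_{\underline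 x}$, with $\deg\partial_i=-\deg x_i$; the degree of a nonzero series or operator is the maximal degree of its terms. $\mathrm{lead}$ denotes the leading (i.e. largest) term, and leading terms are compared through their monomials, $\mathrm{lead}(0)=0$ being smaller than every monomial. For $p=\sum_{\underline\alpha}p_{\underline\alpha}\underline s^{\underline\alpha}$ with $p_{\underline\alpha}\in\mathbb K[\![\underline x]\!]$, let $\mathrm{lead}_{\underline s}(p)=p_{\underline\alpha}\underline s^{\underline\alpha}$ for the $<_{\underline s}$-largest $\underline\alpha$ with $p_{\underline\alpha}\ne0$. Let $\underline g=g_1,\dots,g_l$ be a standard basis of $\langle\underline f\rangle\mathbb K[\![\underline x]\!]$ with respect to $<_{\underline x}$ (nonzero elements of the ideal whose leading terms generate its leading ideal), $U=(\overline u_j)_j\in\mathbb K[\![\underline x]\!]^{\rho\times l}$ with $\underline g=\underline fU$, and $\underline G=\underline FU=\underline g-\underline sDU$. Let $\underline m$ be the finite family of monomials $\underline x^{\underline\beta}\notin\langle\mathrm{lead}(\underline g)\rangle$. Assume $$\deg(s_j)\le\min\deg(\underline m)+\min\deg(\underline x)-\max\deg(\underline d^j)\qquad(1\le j\le m)$$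 (no condition if $\underline m$ is empty or $\underline d^j=0$), and put $N_K=-K\min\deg(\underline s)-\min\deg(\underline x)+\max\deg(D)$ for integers $K\le0$. **The algorithm.** For $p\in\mathbb K[\![\underline s,\underline x]\!]$ and $K\le0$, the output $(r,\overline a,q)=\mathrm{NF}(p,K)$ is computed recursively. Put $q_0=p$ if $p\in\langle\underline s\rangle^{-K}$; otherwise $q_0=\mathrm{lead}_{\underline s}(p)$ if $\deg\mathrm{lead}(p)<N_K$ or $\mathrm{lead}_{\underline s}(p)\in\langle\underline s\rangle^{-K}$; otherwise $q_0=0$. Put $r_0=p-q_0$. * If $r_0=0$, the output is $(0,\overline 0,q_0)$. * If $\mathrm{lead}(r_0)\in\langle\mathrm{lead}(\underline g)\rangle$, let $j$ be minimal with $\mathrm{lead}(r_0)\in\langle\mathrm{lead}(g_j)\rangle$ and $t=\mathrm{lead}(r_0)/\mathrm{lead}(g_j)$; with $(r',\overline a',q')=\mathrm{NF}\bigl(r_0-tg_j+\underline sD(t\overline u_j),K\bigr)$ the output is $(r',\overline a'+t\,\overline e_j,q_0+q')$. * Otherwise, with $(r',\overline a',q')=\mathrm{NF}(r_0-\mathrm{lead}(r_0),K)$,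 the output is $(\mathrm{lead}(r_0)+r',\overline a',q_0+q')$. Let $(K_i)_{i\ge0}$ be a strictly decreasing sequence of integers $K_i\le0$. For $p\in\mathbb K[\![\underline s,\underline x]\!]$ put $p_0=p$, $(r_i,\overline a_i,p_{i+1})=\mathrm{NF}(p_i,K_i)$ for $i\ge0$, and $$\mathrm{NF}(p)=\Bigl(\sum_{i\ge0}r_i,\ \sum_{i\ge0}\overline a_i\Bigr)$$ in the $\langle\underline s,\underline x\rangle$-adic topology. **Lemma.** For every $p\in\mathbb K[\![\underline s,\underline x]\!]$, $\mathrm{NF}(p)$ is well defined (all the computations $\mathrm{NF}(p_i,K_i)$ terminate, and both series converge). Let $(r,\overline a)=\mathrm{NF}(p)$. Then 1. $p=\underline G\,\overline a+r$; 2. $a^i\in\mathbb K[\![\underline s,\underline x]\!]$ with $\mathrm{lead}(G_ia^i)\le\mathrm{lead}(p)$ for $i=1,\dots,l$; 3. $r\in\langle\underline m\rangle\mathbb K[\![\underline s]\!]$ with $\mathrm{lead}(r)\le\mathrm{lead}(p)$; 4. if $p\in\langle\underline m\rangle\mathbb K[\![\underline s]\!]$, then $(r,\overline a)=(p,\overline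 0)$. -/

import Mathlib

open Filter Topology

noncomputable section

namespace PartialSB

/-- A local degree ordering on the monomials `x ^ α`, `α ∈ ℕ ^ σ`: a weighted degree
`deg : ℕ ^ σ → ℚ` with `deg (x i) < 0` for every variable, and a strict total order `lt` on
exponents that is compatible with multiplication of monomials and refines `deg`. -/
structure LocalDegreeOrder (σ : Type*) where
  deg : (σ →₀ ℕ) →+ ℚ
  deg_neg : ∀ i, deg (Finsupp.single i 1) < 0
  lt : (σ →₀ ℕ) → (σ →₀ ℕ) → Prop
  lt_irrefl : ∀ a, ¬ lt a a
  lt_trans : ∀ a b c, lt a b → lt b c → lt a c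
  lt_total : ∀ a b, lt a b ∨ a = b ∨ lt b a
  add_lt_add : ∀ a b c, lt a b → lt (a + c) (b + c)
  lt_of_deg_lt : ∀ a b, deg a < deg b → lt a b

open Classical in
/-- The maximum of a set of exponents for the strict order `lt`. (The value `0` is used only for
sets without a maximum, e.g. the empty set.) -/
def maxExp {σ : Type*} (lt : (σ →₀ ℕ) → (σ →₀ ℕ) → Prop) (S : Set (σ →₀ ℕ)) : σ →₀ ℕ :=
  if h : ∃ e ∈ S, ∀ e' ∈ S, e' = e ∨ lt e' e then h.choose else 0

/-- The support of a power series. -/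
def supp {σ K : Type*} [Field K] (p : MvPowerSeries σ K) : Set (σ →₀ ℕ) :=
  {e | MvPowerSeries.coeff e p ≠ 0}

/-- The leading exponent of a power series. -/
def lexp {σ K : Type*} [Field K] (lt : (σ →₀ ℕ) → (σ →₀ ℕ) → Prop) (p : MvPowerSeries σ K) :
    σ →₀ ℕ :=
  maxExp lt (supp p)

/-- The leading coefficient of a power series. -/
def lcoeff {σ K : Type*} [Field K] (lt : (σ →₀ ℕ) → (σ →₀ ℕ) → Prop) (p : MvPowerSeries σ K) :
    K :=
  MvPowerSeries.coeff (lexp lt p) p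

/-- The leading term of a power series; the leading term of `0` is `0`. -/
def lead {σ K : Type*} [Field K] (lt : (σ →₀ ℕ) → (σ →₀ ℕ) → Prop) (p : MvPowerSeries σ K) :
    MvPowerSeries σ K :=
  MvPowerSeries.monomial (lexp lt p) (lcoeff lt p)

/-- `lead q ≤ lead p`: comparison of the monomials of the leading terms, where the leading term
`0` of the zero series is smaller than every monomial. -/
def LeadLE {σ K : Type*} [Field K] (lt : (σ →₀ ℕ) → (σ →₀ ℕ) → Prop)
    (q p : MvPowerSeries σ K) : Prop :=
  q = 0 ∨ (q ≠ 0 ∧ p ≠ 0 ∧ (lexp lt q = lexp lt p ∨ lt (lexp lt q) (lexp lt p)))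

/-- The ring `K[[s, x]]` with `s = s_1, …, s_m` and `x = x_1, …, x_n`. -/
abbrev Series (K : Type*) (m n : ℕ) := MvPowerSeries (Fin m ⊕ Fin n) K

/-- The exponents of the monomials of `K[[s, x]]`. -/
abbrev Exp (m n : ℕ) := (Fin m ⊕ Fin n) →₀ ℕ

/-- The `s`-part `α` of the exponent of `s ^ α * x ^ β`. -/
def sPart {m n : ℕ} (e : Exp m n) : Fin m →₀ ℕ := (Finsupp.sumFinsuppEquivProdFinsupp e).1

/-- The `x`-part `β` of the exponent of `s ^ α * x ^ β`. -/
def xPart {m n : ℕ} (e : Exp m n) : Fin n →₀ ℕ := (Finsupp.sumFinsuppEquivProdFinsupp e).2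

/-- The inclusion `K[[x]] ⊆ K[[s, x]]`. -/
def ofX {K : Type*} [Field K] (m : ℕ) {n : ℕ} (p : MvPowerSeries (Fin n) K) : Series K m n :=
  MvPowerSeries.rename Sum.inr p

/-- The inclusion `K[[s]] ⊆ K[[s, x]]`. -/
def ofS {K : Type*} [Field K] {m : ℕ} (n : ℕ) (p : MvPowerSeries (Fin m) K) : Series K m n :=
  MvPowerSeries.rename Sum.inl p

/-- The variable `s_j`. -/
def sVar (K : Type*) [Field K] {m : ℕ} (n : ℕ) (j : Fin m) : Series K m n :=
  MvPowerSeries.X (Sum.inl j)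

/-- The ideal `⟨s⟩` of `K[[s, x]]`. -/
def sIdeal (K : Type*) [Field K] (m n : ℕ) : Ideal (Series K m n) :=
  Ideal.span (Set.range (sVar K n))

/-- The ideal `⟨s, x⟩` of `K[[s, x]]`. -/
def sxIdeal (K : Type*) [Field K] (m n : ℕ) : Ideal (Series K m n) :=
  Ideal.span (Set.range MvPowerSeries.X)

/-- `a = ∑ i, u i` with respect to the `⟨s, x⟩`-adic topology: the partial sums converge to `a`. -/
def AdicSum {K : Type*} [Field K] {m n : ℕ} (u : ℕ → Series K m n) (a : Series K m n) : Prop :=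
  Tendsto (fun k => ∑ i ∈ Finset.range k, u i) atTop (@nhds _ (sxIdeal K m n).adicTopology a)

/-- The elements of `K[[s, x]]⟨∂⟩`, written uniquely as finite sums `∑ γ, P γ * ∂ ^ γ` with
coefficients `P γ` in `K[[s, x]]` on the left of the powers of `∂ = ∂_{x_1}, …, ∂_{x_n}`. -/
abbrev DiffOp (K : Type*) [Field K] (m n : ℕ) := (Fin n →₀ ℕ) →₀ Series K m n

/-- The operator `∂ ^ γ` on `K[[s, x]]`, the product of the `∂_{x_i} ^ γ_i`. -/
def partialPow {K : Type*} [Field K] {m n : ℕ} (γ : Fin n →₀ ℕ) :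
    Series K m n →ₗ[K] Series K m n :=
  (List.ofFn fun i : Fin n =>
    ((MvPowerSeries.pderiv K (Sum.inr i : Fin m ⊕ Fin n)).toLinearMap :
      Module.End K (Series K m n)) ^ γ i).prod

/-- The action of a differential operator on `K[[s, x]]`. -/
def DiffOp.act {K : Type*} [Field K] {m n : ℕ} (P : DiffOp K m n) (p : Series K m n) :
    Series K m n :=
  P.sum fun γ c => c * partialPow γ p

/-- The specialization `s = 0` of a power series. -/
def special {K : Type*} [Field K] {m n : ℕ} (p : Series K m n) : MvPowerSeries (Fin n) K :=
  MvPowerSeries.killCompl Function.Embedding.inr p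

/-- The block ordering `(<_s, <_x)` on the monomials of `K[[s, x]]`. -/
def blockLt {m n : ℕ} (oS : LocalDegreeOrder (Fin m)) (oX : LocalDegreeOrder (Fin n))
    (e e' : Exp m n) : Prop :=
  oS.lt (sPart e) (sPart e') ∨ (sPart e = sPart e' ∧ oX.lt (xPart e) (xPart e'))

/-- The weighted degree `deg (s ^ α * x ^ β) = deg_s (s ^ α) + deg_x (x ^ β)`. -/
def totalDeg {m n : ℕ} (oS : LocalDegreeOrder (Fin m)) (oX : LocalDegreeOrder (Fin n))
    (e : Exp m n) : ℚ :=
  oS.deg (sPart e) + oX.deg (xPart e)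

/-- The weighted degrees of the terms `s ^ α * x ^ β * ∂ ^ γ` occurring in a differential operator,
where `deg ∂_i = - deg x_i`. The degree of a nonzero operator is the maximum of this set. -/
def termDegs {K : Type*} [Field K] {m n : ℕ} (oS : LocalDegreeOrder (Fin m))
    (oX : LocalDegreeOrder (Fin n)) (P : DiffOp K m n) : Set ℚ :=
  {q | ∃ γ, ∃ e ∈ supp (P γ), q = totalDeg oS oX e - oX.deg γ}

/-- A formal family `F = F_1, …, F_ρ` of differential operators, together with the choices on
which a partial standard basis and its normal form depend. -/
structure FormalFamily (K : Type*) [Field K] (m n ρ l : ℕ) where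
  F : Fin ρ → DiffOp K m n
  /-- The specialization `F (s = 0)` does not involve `∂`. -/
  special_F : ∀ k γ, γ ≠ 0 → special (F k γ) = 0
  /-- `⟨x⟩ ^ k ⊆ ⟨f⟩` for some `k`, where `f = F (s = 0)`. -/
  finite_f : ∃ k : ℕ, (Ideal.span (Set.range MvPowerSeries.X)) ^ k ≤
    Ideal.span (Set.range fun k => special (F k 0))
  D : Fin m → Fin ρ → DiffOp K m n
  /-- `F = f - s D`. -/
  F_eq : ∀ k, F k = Finsupp.single 0 (ofX m (special (F k 0))) - ∑ j, sVar K n j • D j k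
  /-- the ordering `<_s` with its weighted degree -/
  oS : LocalDegreeOrder (Fin m)
  /-- the ordering `<_x` with its weighted degree -/
  oX : LocalDegreeOrder (Fin n)
  g : Fin l → MvPowerSeries (Fin n) K
  g_ne : ∀ i, g i ≠ 0
  g_mem : ∀ i, g i ∈ Ideal.span (Set.range fun k => special (F k 0))
  /-- `g` is a standard basis of `⟨f⟩`: the leading monomials of `⟨f⟩` are exactly the multiples
  of the `lead (g i)`. -/
  g_std : ∀ h ∈ Ideal.span (Set.range fun k => special (F k 0)), h ≠ 0 →
    ∃ i, lexp oX.lt (g i) ≤ lexp oX.lt h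
  U : Fin ρ → Fin l → MvPowerSeries (Fin n) K
  /-- `g = f U`. -/
  g_eq : ∀ i, g i = ∑ k, special (F k 0) * U k i
  /-- `deg s_j ≤ min deg m + min deg x - max deg d^j` for every `j`, where the components of `m`
  are the monomials `x ^ β` outside `⟨lead g⟩`, and `d^j` is the `j`-th row of `D`. -/
  deg_s_le : ∀ j, ∀ β : Fin n →₀ ℕ, (∀ i, ¬ lexp oX.lt (g i) ≤ β) → ∀ i k,
    ∀ q ∈ termDegs oS oX (D j k),
      oS.deg (Finsupp.single j 1) ≤ oX.deg β + oX.deg (Finsupp.single i 1) - q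
  minDegS : ℚ
  isLeast_minDegS : IsLeast (Set.range fun j => oS.deg (Finsupp.single j 1)) minDegS
  minDegX : ℚ
  isLeast_minDegX : IsLeast (Set.range fun i => oX.deg (Finsupp.single i 1)) minDegX
  maxDegD : ℚ
  isGreatest_maxDegD : IsGreatest (⋃ j, ⋃ k, termDegs oS oX (D j k)) maxDegD

namespace FormalFamily

variable {K : Type*} [Field K] {m n ρ l : ℕ} (S : FormalFamily K m n ρ l)

/-- The ordering `<` on the monomials of `K[[s, x]]`. -/
def lt : Exp m n → Exp m n → Prop := blockLt S.oS S.oX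

/-- The partial standard basis `G = F U`, a row of differential operators, through its action on
`K[[s, x]]`: `G_i a = ∑ k, F_k (U_{k i} a)`. -/
def G (i : Fin l) (a : Series K m n) : Series K m n :=
  ∑ k, (S.F k).act (ofX m (S.U k i) * a)

/-- The set of exponents of `m`, i.e. of the monomials `x ^ β` outside `⟨lead g⟩`. -/
def basisExp : Set (Fin n →₀ ℕ) := {β | ∀ i, ¬ lexp S.oX.lt (S.g i) ≤ β}

/-- `r ∈ ⟨m⟩K[[s]]`: `r` is a finite `K[[s]]`-linear combination of the monomials of `m`. -/
def InBasisSpan (r : Series K m n) : Prop :=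
  ∃ c : (Fin n →₀ ℕ) →₀ MvPowerSeries (Fin m) K, (∀ β ∈ c.support, β ∈ S.basisExp) ∧
    r = c.sum fun β cβ => ofS n cβ * ofX m (MvPowerSeries.monomial β 1)

/-- `N_k = - k * min deg s - min deg x + max deg D`. -/
def N (k : ℤ) : ℚ := -(k : ℚ) * S.minDegS - S.minDegX + S.maxDegD

/-- The leading exponent with respect to the partial ordering `<_s`. -/
def lexpS (p : Series K m n) : Fin m →₀ ℕ := maxExp S.oS.lt (sPart '' supp p)

open Classical in
/-- The leading term `p_α * s ^ α` with respect to `<_s`, where `p = ∑ α, p_α * s ^ α` with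
`p_α ∈ K[[x]]` and `α` is the leading exponent. -/
def leadS (p : Series K m n) : Series K m n :=
  fun e => if sPart e = S.lexpS p then MvPowerSeries.coeff e p else 0

open Classical in
/-- The part of `p` that one call of the normal form algorithm splits off. -/
def splitOff (k : ℤ) (p : Series K m n) : Series K m n :=
  if p ∈ sIdeal K m n ^ (-k).toNat then p
  else if totalDeg S.oS S.oX (lexp S.lt p) < S.N k ∨ S.leadS p ∈ sIdeal K m n ^ (-k).toNat then
    S.leadS p
  else 0

/-- `lead r ∈ ⟨lead g_i⟩`, for `r ≠ 0`. -/
def Reducible (r : Series K m n) (i : Fin l) : Prop :=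
  lexp S.oX.lt (S.g i) ≤ xPart (lexp S.lt r)

/-- The term `lead r / lead g_j`. -/
def quot (r : Series K m n) (j : Fin l) : Series K m n :=
  MvPowerSeries.monomial
    (lexp S.lt r - Finsupp.mapDomain Sum.inr (lexp S.oX.lt (S.g j)))
    (lcoeff S.lt r / lcoeff S.oX.lt (S.g j))

/-- The reduction step `r ↦ r - t * g_j + s D (t * u_j)` with `t = lead r / lead g_j`, where `u_j`
is the `j`-th column of `U`. -/
def reduceStep (r : Series K m n) (j : Fin l) : Series K m n :=
  r - S.quot r j * ofX m (S.g j)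
    + ∑ i, sVar K n i * ∑ k, (S.D i k).act (S.quot r j * ofX m (S.U k j))

/-- The normal form algorithm: `S.NF k p r a q` says that the recursive algorithm, on the input
`(p, k)`, terminates with the output `(r, a, q)`. In every call the part `splitOff k p` is split off
into `q`; the three rules are the three branches taken for the rest `p - splitOff k p`: it is zero;
its leading term lies in `⟨lead g⟩`, and `j` is the smallest index with `lead (p - splitOff k p)` in
`⟨lead g_j⟩`; or its leading term does not lie in `⟨lead g⟩`. -/
inductive NF (k : ℤ) :
    Series K m n → Series K m n → (Fin l → Series K m n) → Series K m n → Prop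
  | done (p : Series K m n) (h : p - S.splitOff k p = 0) :
      NF k p 0 0 (S.splitOff k p)
  | reduce (p : Series K m n) (h : p - S.splitOff k p ≠ 0) (j : Fin l)
      (hj : S.Reducible (p - S.splitOff k p) j)
      (hmin : ∀ i, S.Reducible (p - S.splitOff k p) i → j ≤ i)
      (r : Series K m n) (a : Fin l → Series K m n) (q : Series K m n)
      (call : NF k (S.reduceStep (p - S.splitOff k p) j) r a q) :
      NF k p r (a + Pi.single j (S.quot (p - S.splitOff k p) j)) (S.splitOff k p + q)
  | keep (p : Series K m n) (h : p - S.splitOff k p ≠ 0)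
      (hj : ∀ i, ¬ S.Reducible (p - S.splitOff k p) i)
      (r : Series K m n) (a : Fin l → Series K m n) (q : Series K m n)
      (call : NF k (p - S.splitOff k p - lead S.lt (p - S.splitOff k p)) r a q) :
      NF k p (lead S.lt (p - S.splitOff k p) + r) a (S.splitOff k p + q)

/-- `(r, a) = NF(p)` for the limit normal form with respect to the sequence `κ`: with `p_0 = p` and
`(r_i, a_i, p_{i+1}) = NF(p_i, κ_i)`, where all these computations terminate, `r = ∑ r_i` and
`a = ∑ a_i` in the `⟨s, x⟩`-adic topology. -/
def IsLimitNF (κ : ℕ → ℤ) (p r : Series K m n) (a : Fin l → Series K m n) : Prop :=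
  ∃ (P R : ℕ → Series K m n) (A : ℕ → Fin l → Series K m n), P 0 = p ∧
    (∀ i, S.NF (κ i) (P i) (R i) (A i) (P (i + 1))) ∧
    AdicSum R r ∧ ∀ j, AdicSum (fun i => A i j) (a j)

end FormalFamily

end PartialSB

end

open Filter Topology

noncomputable section

namespace PartialSB

/-! ### Supports of power series -/

section Support

variable {σ K : Type*} [Field K]

/-! Because F = f - sD, a reduction with t = lead(r)/lead(g_j) replaces r by r - G_j(t)
(`reduceStep_eq`). The product t g_j cancels the leading term, and the correction s D(t u_j) has
strictly larger s-exponents, hence lies lower in the local block ordering. So p = G a + r + q holds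
for each finite computation (`NF.eq`), and leading exponents drop.

A local ordering has infinite descending chains, so termination rests on the splitting. While
nothing is split off, the leading exponent ranges over a finite set of exponents of bounded degree.
When the leading part in s is split off, one of finitely many s-exponents disappears for good.
`complexity` counts both resources (`complexity_lt`).

For convergence, give each s_j a large weight C and let x contribute minus its degree. The factor
s_i in the correction gains at least C, while the derivatives and the division by lead(g_j) lose at
most C, so steps never lower the weight. The remainder of order K_i has weight tending to infinity
(`le_weight_of_mem_remExp`), and weight is bounded by a multiple of the total order. Hence p_i, r_i
and a_i tend to zero. Each G_j has finite order, so it is continuous and the identity passes to the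
limit.

Everything else is a support condition, stable under sums and adic limits. `NF.mem_suppIn`
propagates any set of exponents closed under the steps: the exponents at most some exponent of p
give the leading term bounds, and lower bounds on the weight give convergence. Only irreducible
terms are kept in r, and on irreducible input no reduction ever happens. -/

theorem mem_supp {p : MvPowerSeries σ K} {e : σ →₀ ℕ} :
    e ∈ supp p ↔ MvPowerSeries.coeff e p ≠ 0 := Iff.rfl

theorem supp_nonempty {p : MvPowerSeries σ K} (hp : p ≠ 0) : (supp p).Nonempty :=
  (MvPowerSeries.ne_zero_iff_exists_coeff_ne_zero p).1 hp

theorem exists_of_mem_supp_mul {p q : MvPowerSeries σ K} {e : σ →₀ ℕ} (he : e ∈ supp (p * q)) :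
    ∃ a ∈ supp p, ∃ b ∈ supp q, a + b = e := by
  classical
  rw [mem_supp, MvPowerSeries.coeff_mul] at he
  obtain ⟨x, hx, hne⟩ := Finset.exists_ne_zero_of_sum_ne_zero he
  exact ⟨x.1, left_ne_zero_of_mul hne, x.2, right_ne_zero_of_mul hne,
    Finset.HasAntidiagonal.mem_antidiagonal.1 hx⟩

theorem eq_of_mem_supp_monomial {a e : σ →₀ ℕ} {c : K}
    (he : e ∈ supp (MvPowerSeries.monomial a c)) : e = a :=
  MvPowerSeries.eq_of_coeff_monomial_ne_zero he

variable (K) in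
/-- The power series all of whose exponents lie in a given set. -/
def suppIn (A : Set (σ →₀ ℕ)) : AddSubgroup (MvPowerSeries σ K) where
  carrier := {p | supp p ⊆ A}
  zero_mem' := fun e he => absurd (map_zero _) he
  add_mem' := by
    intro p q hp hq e he
    by_cases h : MvPowerSeries.coeff e p = 0
    · refine hq fun h' => he ?_
      rw [map_add, h, h', add_zero]
    · exact hp h
  neg_mem' := by
    intro p hp e he
    refine hp fun h' => he ?_
    rw [map_neg, h', neg_zero]

theorem mem_suppIn {A : Set (σ →₀ ℕ)} {p : MvPowerSeries σ K} :
    p ∈ suppIn K A ↔ ∀ e ∈ supp p, e ∈ A := Iff.rfl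

theorem suppIn_mono {A B : Set (σ →₀ ℕ)} (h : A ⊆ B) : suppIn K A ≤ suppIn K B :=
  fun _ hp => Set.Subset.trans hp h

theorem coeff_eq_zero_of_mem_suppIn {A : Set (σ →₀ ℕ)} {p : MvPowerSeries σ K}
    (hp : p ∈ suppIn K A) {e : σ →₀ ℕ} (he : e ∉ A) : MvPowerSeries.coeff e p = 0 :=
  by_contra fun h => he (hp h)

theorem mem_suppIn_supp (p : MvPowerSeries σ K) : p ∈ suppIn K (supp p) := fun _ h => h

theorem monomial_mem_suppIn {A : Set (σ →₀ ℕ)} {e : σ →₀ ℕ} (he : e ∈ A) (c : K) :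
    MvPowerSeries.monomial e c ∈ suppIn K A :=
  fun _ h => eq_of_mem_supp_monomial h ▸ he

/-- The powers of an ideal generated by variables consist of the power series of high order in
these variables. -/
theorem mem_span_X_pow_iff {ι : Type*} [Fintype ι] (v : ι → σ) (hv : Function.Injective v)
    (N : ℕ) (p : MvPowerSeries σ K) :
    p ∈ Ideal.span (Set.range fun i => (MvPowerSeries.X (v i) : MvPowerSeries σ K)) ^ N ↔
      ∀ e ∈ supp p, N ≤ ∑ i, e (v i) := by
  classical
  constructor
  · induction N generalizing p with
    | zero => intros; exact Nat.zero_le _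
    | succ N ih =>
      intro hp
      rw [pow_succ] at hp
      induction hp using Submodule.mul_induction_on' with
      | mem_mul_mem x hx y hy =>
        intro e he
        obtain ⟨a, ha, b, hb, rfl⟩ := exists_of_mem_supp_mul he
        have h1 := ih x hx a ha
        have h2 : 1 ≤ ∑ i, b (v i) := by
          clear he
          induction hy using Submodule.span_induction generalizing b with
          | mem z hz =>
            obtain ⟨i, rfl⟩ := hz
            have : b = Finsupp.single (v i) 1 := eq_of_mem_supp_monomial hb
            subst this
            refine le_trans ?_ (Finset.single_le_sum
              (f := fun k => (Finsupp.single (v i) 1 : σ →₀ ℕ) (v k))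
              (fun _ _ => Nat.zero_le _) (Finset.mem_univ i))
            simp
          | zero => exact absurd (map_zero _) hb
          | add y z _ _ hy hz =>
            by_contra hlt
            refine hb ?_
            rw [map_add, not_not.1 (mt (hy b) hlt), not_not.1 (mt (hz b) hlt), add_zero]
          | smul c y _ hy =>
            obtain ⟨b₁, _, b₂, hb₂, rfl⟩ := exists_of_mem_supp_mul hb
            refine (hy b₂ hb₂).trans (Finset.sum_le_sum fun i _ => ?_)
            simp
        have h3 : ∑ i, (a + b) (v i) = ∑ i, a (v i) + ∑ i, b (v i) := by
          simp [Finset.sum_add_distrib]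
        omega
      | add x _ y _ hx hy =>
        intro e he
        by_contra hlt
        refine he ?_
        rw [map_add, not_not.1 (mt (hx e) hlt), not_not.1 (mt (hy e) hlt), add_zero]
  · induction N generalizing p with
    | zero => intro _; simp
    | succ N ih =>
      intro hp
      -- Each exponent involving the chosen variables is assigned to exactly one of them, so the
      -- products `P i * X (v i)` partition the terms of `p`.
      have hex : ∀ e : σ →₀ ℕ, ∃ o : Option ι, (∀ i, o = some i → e (v i) ≠ 0) ∧
          (o = none → ∀ i, e (v i) = 0) := by
        intro e
        by_cases h : ∃ i, e (v i) ≠ 0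
        · obtain ⟨i, hi⟩ := h
          exact ⟨some i, fun j h => Option.some.inj h ▸ hi, nofun⟩
        · push Not at h
          exact ⟨none, nofun, fun _ => h⟩
      choose o ho using hex
      let P : ι → MvPowerSeries σ K := fun i e =>
        if o (e + Finsupp.single (v i) 1) = some i then
          MvPowerSeries.coeff (e + Finsupp.single (v i) 1) p else 0
      have hP : ∀ i e, MvPowerSeries.coeff e (P i) =
        if o (e + Finsupp.single (v i) 1) = some i then
          MvPowerSeries.coeff (e + Finsupp.single (v i) 1) p else 0 := fun _ _ => rfl
      have hsum : p = ∑ i, P i * MvPowerSeries.X (v i) := by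
        ext e
        rw [map_sum]
        have hterm : ∀ i, MvPowerSeries.coeff e (P i * MvPowerSeries.X (v i)) =
            if o e = some i then MvPowerSeries.coeff e p else 0 := by
          intro i
          rw [MvPowerSeries.X, MvPowerSeries.coeff_mul_monomial, mul_one]
          by_cases hi : Finsupp.single (v i) 1 ≤ e
          · rw [if_pos hi, hP, tsub_add_cancel_of_le hi]
          · rw [if_neg hi, if_neg]
            intro h
            refine hi ?_
            rw [Finsupp.single_le_iff]
            exact Nat.one_le_iff_ne_zero.2 ((ho e).1 i h)
        simp only [hterm]
        rcases h : o e with _ | i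
        · have h0 : ∑ i, e (v i) = 0 := Finset.sum_eq_zero fun i _ => (ho e).2 h i
          have : MvPowerSeries.coeff e p = 0 := by
            by_contra hne
            have := hp e hne
            omega
          simp [this]
        · simp
      rw [hsum, pow_succ]
      refine Ideal.sum_mem _ fun i _ => Ideal.mul_mem_mul (ih _ ?_)
        (Ideal.subset_span ⟨i, rfl⟩)
      intro e he
      rw [mem_supp, hP] at he
      split_ifs at he with hoe
      · have h1 := hp _ he
        have h2 : ∑ k, (e + Finsupp.single (v i) 1 : σ →₀ ℕ) (v k) = ∑ k, e (v k) + 1 := by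
          simp [Finset.sum_add_distrib, Finsupp.single_apply, hv.eq_iff]
        omega
      · exact absurd rfl he

end Support

/-! ### Local degree orderings -/

namespace LocalDegreeOrder

variable {σ : Type*} (o : LocalDegreeOrder σ)

theorem deg_nonpos (a : σ →₀ ℕ) : o.deg a ≤ 0 := by
  induction a using Finsupp.induction_linear with
  | zero => simp
  | add a b ha hb => rw [map_add]; linarith
  | single i k =>
    have : (Finsupp.single i k : σ →₀ ℕ) = k • Finsupp.single i 1 := by simp
    rw [this, map_nsmul, nsmul_eq_mul]
    exact mul_nonpos_of_nonneg_of_nonpos (Nat.cast_nonneg k) (o.deg_neg i).le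

theorem deg_anti {a b : σ →₀ ℕ} (h : a ≤ b) : o.deg b ≤ o.deg a := by
  obtain ⟨c, rfl⟩ := exists_add_of_le h
  rw [map_add]
  linarith [o.deg_nonpos c]

theorem deg_eq_sum [Fintype σ] (a : σ →₀ ℕ) :
    o.deg a = ∑ i, (a i : ℚ) * o.deg (Finsupp.single i 1) := by
  have : a = ∑ i, a i • Finsupp.single i 1 := by
    ext j
    simp
  conv_lhs => rw [this]
  simp only [map_sum, map_nsmul, nsmul_eq_mul]

theorem deg_neg_of_ne_zero {a : σ →₀ ℕ} (h : a ≠ 0) : o.deg a < 0 := by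
  obtain ⟨i, hi⟩ := Finsupp.ne_iff.1 h
  have : Finsupp.single i 1 ≤ a := Finsupp.single_le_iff.2 (Nat.one_le_iff_ne_zero.2 hi)
  exact (o.deg_anti this).trans_lt (o.deg_neg i)

theorem lt_of_le_of_ne {a b : σ →₀ ℕ} (h : a ≤ b) (hne : a ≠ b) : o.lt b a := by
  obtain ⟨c, rfl⟩ := exists_add_of_le h
  apply o.lt_of_deg_lt
  have hc : c ≠ 0 := fun h => hne (by simp [h])
  rw [map_add]
  linarith [o.deg_neg_of_ne_zero hc]

theorem deg_le_of_lt {a b : σ →₀ ℕ} (h : o.lt a b) : o.deg a ≤ o.deg b := by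
  by_contra! h'
  exact o.lt_irrefl _ (o.lt_trans _ _ _ h (o.lt_of_deg_lt _ _ h'))

/-- Every variable has negative degree, so a lower bound on the degree bounds each exponent
separately. -/
theorem finite_deg_ge [Finite σ] (c : ℚ) : {a : σ →₀ ℕ | c ≤ o.deg a}.Finite := by
  classical
  cases nonempty_fintype σ
  refine (Set.finite_Iic (Finsupp.equivFunOnFinite.symm fun i =>
    ⌊c / o.deg (Finsupp.single i 1)⌋₊)).subset fun a ha i => ?_
  have hi := o.deg_neg i
  have h1 : Finsupp.single i (a i) ≤ a := Finsupp.single_le_iff.2 le_rfl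
  have h2 := o.deg_anti h1
  have h3 : (Finsupp.single i (a i) : σ →₀ ℕ) = a i • Finsupp.single i 1 := by simp
  rw [h3, map_nsmul, nsmul_eq_mul] at h2
  show a i ≤ ⌊c / o.deg (Finsupp.single i 1)⌋₊
  refine Nat.le_floor ?_
  rw [le_div_iff_of_neg hi]
  exact le_trans ha h2

theorem finite_gt [Finite σ] (a : σ →₀ ℕ) : {b | o.lt a b}.Finite :=
  (o.finite_deg_ge (o.deg a)).subset fun _ hb => o.deg_le_of_lt hb

/-- Only finitely many exponents lie above a given one, and their number drops strictly on moving
up. -/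
theorem wellFounded_gt [Finite σ] : WellFounded fun a b => o.lt b a := by
  refine Subrelation.wf (r := InvImage (· < ·) fun a => {b | o.lt a b}.ncard) ?_
    (InvImage.wf _ wellFounded_lt)
  intro a b hab
  refine Set.ncard_lt_ncard ⟨fun c hc => o.lt_trans _ _ _ hab hc, fun h => ?_⟩ (o.finite_gt b)
  exact o.lt_irrefl _ (h hab)

end LocalDegreeOrder

/-! ### Greatest elements of sets of exponents -/

section MaxExp

variable {σ : Type*} {lt : (σ →₀ ℕ) → (σ →₀ ℕ) → Prop}

theorem maxExp_spec (hwf : WellFounded fun a b => lt b a)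
    (htot : ∀ a b, lt a b ∨ a = b ∨ lt b a) {S : Set (σ →₀ ℕ)} (hS : S.Nonempty) :
    maxExp lt S ∈ S ∧ ∀ e ∈ S, e = maxExp lt S ∨ lt e (maxExp lt S) := by
  have h : ∃ e ∈ S, ∀ e' ∈ S, e' = e ∨ lt e' e := by
    obtain ⟨e, he, hmin⟩ := hwf.has_min S hS
    refine ⟨e, he, fun e' he' => ?_⟩
    rcases htot e' e with h | h | h
    · exact Or.inr h
    · exact Or.inl h
    · exact absurd h (hmin e' he')
  rw [maxExp, dif_pos h]
  exact h.choose_spec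

end MaxExp

theorem LocalDegreeOrder.lexp_mem {σ K : Type*} [Finite σ] [Field K] (o : LocalDegreeOrder σ)
    {p : MvPowerSeries σ K} (hp : p ≠ 0) : lexp o.lt p ∈ supp p :=
  (maxExp_spec o.wellFounded_gt o.lt_total (supp_nonempty hp)).1

theorem LocalDegreeOrder.le_lexp {σ K : Type*} [Finite σ] [Field K] (o : LocalDegreeOrder σ)
    {p : MvPowerSeries σ K} {e : σ →₀ ℕ} (he : e ∈ supp p) :
    e = lexp o.lt p ∨ o.lt e (lexp o.lt p) :=
  (maxExp_spec o.wellFounded_gt o.lt_total ⟨e, he⟩).2 e he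

/-! ### Exponents in two blocks of variables -/

section Exponents

variable {m n : ℕ}

@[simp] theorem sPart_apply (e : Exp m n) (i : Fin m) : sPart e i = e (Sum.inl i) := rfl

@[simp] theorem xPart_apply (e : Exp m n) (i : Fin n) : xPart e i = e (Sum.inr i) := rfl

@[simp] theorem sPart_add (e e' : Exp m n) : sPart (e + e') = sPart e + sPart e' := by
  ext; simp

@[simp] theorem xPart_add (e e' : Exp m n) : xPart (e + e') = xPart e + xPart e' := by
  ext; simp

@[simp] theorem sPart_tsub (e e' : Exp m n) : sPart (e - e') = sPart e - sPart e' := by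
  ext; simp

@[simp] theorem xPart_tsub (e e' : Exp m n) : xPart (e - e') = xPart e - xPart e' := by
  ext; simp

theorem exp_ext {e e' : Exp m n} (hs : sPart e = sPart e') (hx : xPart e = xPart e') : e = e' := by
  ext i
  rcases i with i | i
  · exact DFunLike.congr_fun hs i
  · exact DFunLike.congr_fun hx i

theorem exp_le_iff {e e' : Exp m n} : e ≤ e' ↔ sPart e ≤ sPart e' ∧ xPart e ≤ xPart e' := by
  refine ⟨fun h => ⟨fun i => h _, fun i => h _⟩, fun h i => ?_⟩
  rcases i with i | i
  · exact h.1 i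
  · exact h.2 i

variable (m) in
/-- The exponent of a monomial in `x`, as an exponent of a monomial in `s` and `x`. -/
def xExp (β : Fin n →₀ ℕ) : Exp m n := Finsupp.mapDomain Sum.inr β

variable (n) in
/-- The exponent of a monomial in `s`, as an exponent of a monomial in `s` and `x`. -/
def sExp (α : Fin m →₀ ℕ) : Exp m n := Finsupp.mapDomain Sum.inl α

@[simp] theorem sPart_xExp (β : Fin n →₀ ℕ) : sPart (xExp m β) = 0 := by
  ext i
  simp [xExp, Finsupp.mapDomain_of_notMem_range]

@[simp] theorem xPart_xExp (β : Fin n →₀ ℕ) : xPart (xExp m β) = β := by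
  ext i
  simp [xExp, Finsupp.mapDomain_apply Sum.inr_injective]

@[simp] theorem sPart_sExp (α : Fin m →₀ ℕ) : sPart (sExp n α) = α := by
  ext i
  simp [sExp, Finsupp.mapDomain_apply Sum.inl_injective]

@[simp] theorem xPart_sExp (α : Fin m →₀ ℕ) : xPart (sExp n α) = 0 := by
  ext i
  simp [sExp, Finsupp.mapDomain_of_notMem_range]

theorem xExp_le_iff {β : Fin n →₀ ℕ} {e : Exp m n} : xExp m β ≤ e ↔ β ≤ xPart e := by
  simp [exp_le_iff]

theorem sum_exp (e : Exp m n) : ∑ i, e i = ∑ i, sPart e i + ∑ i, xPart e i := by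
  simp

end Exponents

/-! ### The block ordering -/

section BlockOrder

variable {m n : ℕ} (oS : LocalDegreeOrder (Fin m)) (oX : LocalDegreeOrder (Fin n))

theorem blockLt_irrefl (e : Exp m n) : ¬ blockLt oS oX e e := by
  rintro (h | ⟨-, h⟩)
  · exact oS.lt_irrefl _ h
  · exact oX.lt_irrefl _ h

variable {oS oX} in
theorem blockLt_trans {a b c : Exp m n} (hab : blockLt oS oX a b) (hbc : blockLt oS oX b c) :
    blockLt oS oX a c := by
  rcases hab with h | ⟨h, h'⟩ <;> rcases hbc with k | ⟨k, k'⟩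
  · exact Or.inl (oS.lt_trans _ _ _ h k)
  · exact Or.inl (k ▸ h)
  · exact Or.inl (h ▸ k)
  · exact Or.inr ⟨h.trans k, oX.lt_trans _ _ _ h' k'⟩

theorem blockLt_total (a b : Exp m n) : blockLt oS oX a b ∨ a = b ∨ blockLt oS oX b a := by
  rcases oS.lt_total (sPart a) (sPart b) with h | h | h
  · exact Or.inl (Or.inl h)
  · rcases oX.lt_total (xPart a) (xPart b) with k | k | k
    · exact Or.inl (Or.inr ⟨h, k⟩)
    · exact Or.inr (Or.inl (exp_ext h k))
    · exact Or.inr (Or.inr (Or.inr ⟨h.symm, k⟩))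
  · exact Or.inr (Or.inr (Or.inl h))

/-- Up-sets of the block ordering can be infinite, so the counting argument for one block is
replaced by a lexicographic product. -/
theorem wellFounded_blockGt : WellFounded fun a b : Exp m n => blockLt oS oX b a := by
  refine Subrelation.wf (r := InvImage (Prod.Lex (fun a b => oS.lt b a) fun a b => oX.lt b a)
    fun e : Exp m n => (sPart e, xPart e)) ?_
    (InvImage.wf _ (WellFounded.prod_lex oS.wellFounded_gt oX.wellFounded_gt))
  rintro a b (h | ⟨h, h'⟩)
  · exact Prod.Lex.left _ _ h
  · show Prod.Lex _ _ (sPart a, xPart a) (sPart b, xPart b)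
    rw [← h]
    exact Prod.Lex.right _ h'

/-- The weak form of the block ordering. -/
def blockLe (e e' : Exp m n) : Prop := e = e' ∨ blockLt oS oX e e'

variable {oS oX}

theorem blockLe_trans {a b c : Exp m n} (hab : blockLe oS oX a b) (hbc : blockLe oS oX b c) :
    blockLe oS oX a c := by
  rcases hab with rfl | h
  · exact hbc
  · rcases hbc with rfl | k
    · exact Or.inr h
    · exact Or.inr (blockLt_trans h k)

theorem blockLt_of_lt_of_le {a b c : Exp m n} (hab : blockLt oS oX a b)
    (hbc : blockLe oS oX b c) : blockLt oS oX a c := by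
  rcases hbc with rfl | k
  · exact hab
  · exact blockLt_trans hab k

variable {K : Type*} [Field K]

theorem lexp_blockLt_mem {p : Series K m n} (hp : p ≠ 0) : lexp (blockLt oS oX) p ∈ supp p :=
  (maxExp_spec (wellFounded_blockGt oS oX) (blockLt_total oS oX) (supp_nonempty hp)).1

theorem blockLe_lexp {p : Series K m n} {e : Exp m n} (he : e ∈ supp p) :
    blockLe oS oX e (lexp (blockLt oS oX) p) :=
  (maxExp_spec (wellFounded_blockGt oS oX) (blockLt_total oS oX) ⟨e, he⟩).2 e he

variable (oS oX) in
/-- The exponents that are at most some exponent of `p`. -/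
def lowerSupp (p : Series K m n) : Set (Exp m n) := {e | ∃ e' ∈ supp p, blockLe oS oX e e'}

/-- Turns comparisons of leading terms into support conditions, which survive sums and adic limits.
-/
theorem leadLE_of_mem_suppIn {p q : Series K m n} (h : q ∈ suppIn K (lowerSupp oS oX p)) :
    LeadLE (blockLt oS oX) q p := by
  by_cases hq : q = 0
  · exact Or.inl hq
  · obtain ⟨e', he', hle⟩ := h (lexp_blockLt_mem (oS := oS) (oX := oX) hq)
    refine Or.inr ⟨hq, ?_, blockLe_trans hle (blockLe_lexp he')⟩
    rintro rfl
    exact he' (map_zero _)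

end BlockOrder

/-! ### Ideals, the adic topology and coefficients -/

section Adic

variable {K : Type*} [Field K] {m n : ℕ}

theorem mem_sIdeal_pow_iff (N : ℕ) (p : Series K m n) :
    p ∈ sIdeal K m n ^ N ↔ ∀ e ∈ supp p, N ≤ ∑ i, sPart e i :=
  mem_span_X_pow_iff (fun i : Fin m => (Sum.inl i : Fin m ⊕ Fin n)) Sum.inl_injective N p

theorem mem_sxIdeal_pow_iff (N : ℕ) (p : Series K m n) :
    p ∈ sxIdeal K m n ^ N ↔ ∀ e ∈ supp p, N ≤ ∑ i, e i :=
  mem_span_X_pow_iff (fun i : Fin m ⊕ Fin n => i) Function.injective_id N p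

/-- Powers of the ideal are the series of high total order, so convergence means that all
coefficients below a given order eventually become stationary. -/
theorem adicSum_iff {u : ℕ → Series K m n} {a : Series K m n} :
    AdicSum u a ↔ ∀ N : ℕ, ∃ k₀, ∀ k ≥ k₀, ∀ e : Exp m n, ∑ i, e i < N →
      MvPowerSeries.coeff e (∑ i ∈ Finset.range k, u i) = MvPowerSeries.coeff e a := by
  have key : ∀ N k, (∑ i ∈ Finset.range k, u i) ∈
      (fun y => a + y) '' ((sxIdeal K m n ^ N : Ideal (Series K m n)) : Set (Series K m n)) ↔
      ∀ e : Exp m n, ∑ i, e i < N →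
      MvPowerSeries.coeff e (∑ i ∈ Finset.range k, u i) = MvPowerSeries.coeff e a := by
    intro N k
    have : (∑ i ∈ Finset.range k, u i) ∈
      (fun y => a + y) '' ((sxIdeal K m n ^ N : Ideal (Series K m n)) : Set (Series K m n)) ↔
      (∑ i ∈ Finset.range k, u i) - a ∈ sxIdeal K m n ^ N := by
      constructor
      · rintro ⟨y, hy, h⟩
        rw [← h]
        simpa using hy
      · intro h
        exact ⟨_, h, by simp⟩
    rw [this, mem_sxIdeal_pow_iff]
    refine forall_congr' fun e => ?_
    rw [mem_supp, map_sub, sub_ne_zero, ← not_lt, not_imp_not]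
  unfold AdicSum
  rw [((sxIdeal K m n).hasBasis_nhds_adic a).tendsto_right_iff]
  simp only [true_implies, eventually_atTop, key]

theorem AdicSum.unique {u : ℕ → Series K m n} {a b : Series K m n} (ha : AdicSum u a)
    (hb : AdicSum u b) : a = b := by
  rw [adicSum_iff] at ha hb
  ext e
  obtain ⟨k, hk⟩ := ha (∑ i, e i + 1)
  obtain ⟨k', hk'⟩ := hb (∑ i, e i + 1)
  rw [← hk (max k k') (le_max_left _ _) e (Nat.lt_succ_self _),
    ← hk' (max k k') (le_max_right _ _) e (Nat.lt_succ_self _)]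

theorem AdicSum.mem_suppIn {u : ℕ → Series K m n} {a : Series K m n} (h : AdicSum u a)
    {A : Set (Exp m n)} (hu : ∀ i, u i ∈ suppIn K A) : a ∈ suppIn K A := by
  intro e he
  obtain ⟨k, hk⟩ := adicSum_iff.1 h (∑ i, e i + 1)
  have := hk k le_rfl e (Nat.lt_succ_self _)
  rw [mem_supp, ← this] at he
  exact (sum_mem fun i _ => hu i : ∑ i ∈ Finset.range k, u i ∈ suppIn K A) he

/-- A series whose terms tend to zero converges. -/
theorem exists_adicSum {u : ℕ → Series K m n}
    (hu : ∀ N : ℕ, ∃ k₀, ∀ i ≥ k₀, ∀ e : Exp m n, ∑ i, e i < N →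
      MvPowerSeries.coeff e (u i) = 0) : ∃ a, AdicSum u a := by
  choose κ hκ using hu
  -- The coefficient at `e` is read off a partial sum past which it no longer changes; the `+ 1` is
  -- due to the strict bound on the order.
  let a : Series K m n := fun e =>
    MvPowerSeries.coeff e (∑ i ∈ Finset.range (κ (∑ i, e i + 1)), u i)
  have ha : ∀ e, MvPowerSeries.coeff e a =
    MvPowerSeries.coeff e (∑ i ∈ Finset.range (κ (∑ i, e i + 1)), u i) := fun _ => rfl
  refine ⟨a, adicSum_iff.2 ?_⟩
  have hstab : ∀ N k, κ N ≤ k → ∀ e : Exp m n, ∑ i, e i < N →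
      MvPowerSeries.coeff e (∑ i ∈ Finset.range k, u i) =
      MvPowerSeries.coeff e (∑ i ∈ Finset.range (κ N), u i) := by
    intro N k hk e he
    rw [← Finset.sum_range_add_sum_Ico _ hk, map_add, add_eq_left, map_sum]
    exact Finset.sum_eq_zero fun i hi => hκ N i (Finset.mem_Ico.1 hi).1 e he
  intro N
  refine ⟨κ N, fun k hk e he => ?_⟩
  rw [ha, hstab N k hk e he, ← hstab N _ (le_max_left _ (κ (∑ i, e i + 1))) e he,
    hstab _ _ (le_max_right _ _) e (Nat.lt_succ_self _)]

end Adic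

/-! ### The inclusions of the power series in one block of variables -/

section Inclusions

variable {K : Type*} [Field K] {m n : ℕ}

theorem coeff_xExp_ofX (p : MvPowerSeries (Fin n) K) (β : Fin n →₀ ℕ) :
    MvPowerSeries.coeff (xExp m β) (ofX m p) = MvPowerSeries.coeff β p := by
  have h := MvPowerSeries.coeff_embDomain_rename (Function.Embedding.inr : Fin n ↪ Fin m ⊕ Fin n)
    p β
  rwa [Finsupp.embDomain_eq_mapDomain] at h

theorem coeff_sExp_ofS (p : MvPowerSeries (Fin m) K) (α : Fin m →₀ ℕ) :
    MvPowerSeries.coeff (sExp n α) (ofS n p) = MvPowerSeries.coeff α p := by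
  have h := MvPowerSeries.coeff_embDomain_rename (Function.Embedding.inl : Fin m ↪ Fin m ⊕ Fin n)
    p α
  rwa [Finsupp.embDomain_eq_mapDomain] at h

theorem exists_of_mem_supp_ofX {p : MvPowerSeries (Fin n) K} {e : Exp m n}
    (he : e ∈ supp (ofX m p)) : ∃ β ∈ supp p, xExp m β = e := by
  by_cases h : e ∈ Set.range (Finsupp.mapDomain (M := ℕ) (Sum.inr : Fin n → Fin m ⊕ Fin n))
  · obtain ⟨β, rfl⟩ := h
    exact ⟨β, fun h => he ((coeff_xExp_ofX p β).trans h), rfl⟩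
  · exact absurd (MvPowerSeries.coeff_rename_eq_zero _ p h) he

theorem exists_of_mem_supp_ofS {p : MvPowerSeries (Fin m) K} {e : Exp m n}
    (he : e ∈ supp (ofS n p)) : ∃ α ∈ supp p, sExp n α = e := by
  by_cases h : e ∈ Set.range (Finsupp.mapDomain (M := ℕ) (Sum.inl : Fin m → Fin m ⊕ Fin n))
  · obtain ⟨β, rfl⟩ := h
    exact ⟨β, fun h => he ((coeff_sExp_ofS p β).trans h), rfl⟩
  · exact absurd (MvPowerSeries.coeff_rename_eq_zero _ p h) he

theorem ofX_monomial (β : Fin n →₀ ℕ) (c : K) :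
    ofX m (MvPowerSeries.monomial β c) = MvPowerSeries.monomial (xExp m β) c :=
  MvPowerSeries.rename_monomial _ _ _

theorem ofX_mul (p q : MvPowerSeries (Fin n) K) : ofX m (p * q) = ofX m p * ofX m q :=
  map_mul (MvPowerSeries.rename _) p q

theorem ofX_sum {ι : Type*} (s : Finset ι) (p : ι → MvPowerSeries (Fin n) K) :
    ofX m (∑ i ∈ s, p i) = ∑ i ∈ s, ofX m (p i) :=
  map_sum (MvPowerSeries.rename _) p s

end Inclusions

/-! ### The action of differential operators -/

section Operators

variable {K : Type*} [Field K] {m n : ℕ}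

/-- The operator `T` lowers all exponents by `d`. -/
def LowersBy (T : Module.End K (Series K m n)) (d : Exp m n) : Prop :=
  ∀ p, ∀ e ∈ supp (T p), e + d ∈ supp p

theorem LowersBy.one : LowersBy (1 : Module.End K (Series K m n)) 0 := fun _ e he => by
  rw [add_zero]; exact he

theorem LowersBy.mul {T T' : Module.End K (Series K m n)} {d d' : Exp m n} (h : LowersBy T d)
    (h' : LowersBy T' d') : LowersBy (T * T') (d + d') := fun p e he => by
  rw [← add_assoc]
  exact h' p _ (h (T' p) e he)

theorem LowersBy.pow {T : Module.End K (Series K m n)} {d : Exp m n} (h : LowersBy T d) (k : ℕ) :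
    LowersBy (T ^ k) (k • d) := by
  induction k with
  | zero => simpa using LowersBy.one
  | succ k ih => rw [pow_succ, succ_nsmul]; exact ih.mul h

theorem LowersBy.listProd {ι : Type*} (T : ι → Module.End K (Series K m n)) (d : ι → Exp m n)
    (h : ∀ i, LowersBy (T i) (d i)) (L : List ι) : LowersBy (L.map T).prod (L.map d).sum := by
  induction L with
  | nil => simpa using LowersBy.one
  | cons i L ih => simpa using (h i).mul ih

theorem lowersBy_pderiv (i : Fin m ⊕ Fin n) :
    LowersBy ((MvPowerSeries.pderiv K i).toLinearMap : Module.End K (Series K m n))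
      (Finsupp.single i 1) := by
  intro p e he h
  refine he ?_
  show MvPowerSeries.coeff e (MvPowerSeries.pderiv K i p) = 0
  rw [MvPowerSeries.coeff_pderiv, h, zero_mul]

theorem lowersBy_partialPow (γ : Fin n →₀ ℕ) :
    LowersBy (partialPow γ : Module.End K (Series K m n)) (xExp m γ) := by
  have h := LowersBy.listProd _ _
    (fun i : Fin n => (lowersBy_pderiv (K := K) (Sum.inr i : Fin m ⊕ Fin n)).pow (γ i))
    (List.finRange n)
  rw [← List.ofFn_eq_map, ← List.ofFn_eq_map, List.sum_ofFn] at h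
  have hγ : ∑ i, γ i • (Finsupp.single (Sum.inr i) 1 : Exp m n) = xExp m γ := by
    refine exp_ext ?_ ?_
    · ext i; simp
    · ext i; simp [Finsupp.single_apply]
  rw [hγ] at h
  exact h

theorem DiffOp.act_eq_linearCombination (P : DiffOp K m n) (p : Series K m n) :
    P.act p = Finsupp.linearCombination (Series K m n) (fun γ => partialPow γ p) P := rfl

theorem DiffOp.act_add (P : DiffOp K m n) (p q : Series K m n) :
    P.act (p + q) = P.act p + P.act q := by
  simp only [DiffOp.act, Finsupp.sum, map_add, mul_add, Finset.sum_add_distrib]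

theorem DiffOp.act_single_zero (c p : Series K m n) :
    DiffOp.act (Finsupp.single 0 c) p = c * p := by
  have h : (partialPow 0 : Module.End K (Series K m n)) = 1 := by
    simp [partialPow]
  rw [DiffOp.act_eq_linearCombination, Finsupp.linearCombination_single, smul_eq_mul, h]
  rfl

/-- Coefficients only raise exponents, so the whole loss comes from `∂ ^ γ`. -/
theorem DiffOp.exists_of_mem_supp_act {P : DiffOp K m n} {p : Series K m n} {e : Exp m n}
    (he : e ∈ supp (P.act p)) : ∃ γ ∈ P.support, ∃ e' ∈ supp p, e' ≤ e + xExp m γ := by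
  refine (?_ : P.act p ∈ suppIn K {e | ∃ γ ∈ P.support, ∃ e' ∈ supp p, e' ≤ e + xExp m γ}) he
  refine sum_mem fun γ hγ e he => ?_
  obtain ⟨a, -, b, hb, rfl⟩ := exists_of_mem_supp_mul he
  refine ⟨γ, hγ, _, lowersBy_partialPow γ p b hb, ?_⟩
  gcongr
  exact le_add_self

end Operators

/-! ### Convergence -/

section AdicSum

variable {K : Type*} [Field K] {m n : ℕ}

theorem AdicSum.zero : AdicSum (fun _ => 0 : ℕ → Series K m n) 0 :=
  adicSum_iff.2 fun _ => ⟨0, fun _ _ _ _ => by simp⟩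

theorem AdicSum.add {u v : ℕ → Series K m n} {a b : Series K m n} (hu : AdicSum u a)
    (hv : AdicSum v b) : AdicSum (fun i => u i + v i) (a + b) := by
  rw [adicSum_iff] at *
  intro N
  obtain ⟨k, hk⟩ := hu N
  obtain ⟨k', hk'⟩ := hv N
  refine ⟨max k k', fun i hi e he => ?_⟩
  rw [Finset.sum_add_distrib, map_add, map_add, hk i (le_trans (le_max_left _ _) hi) e he,
    hk' i (le_trans (le_max_right _ _) hi) e he]

theorem AdicSum.finsetSum {ι : Type*} (s : Finset ι) {u : ι → ℕ → Series K m n}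
    {a : ι → Series K m n} (h : ∀ j, AdicSum (u j) (a j)) :
    AdicSum (fun i => ∑ j ∈ s, u j i) (∑ j ∈ s, a j) := by
  classical
  induction s using Finset.induction_on with
  | empty => simpa using AdicSum.zero
  | insert j s hj ih => simpa [Finset.sum_insert hj] using (h j).add ih

/-- An additive map that lowers the order by at most `d` is continuous. -/
theorem AdicSum.map {u : ℕ → Series K m n} {a : Series K m n} (h : AdicSum u a)
    (T : Series K m n →+ Series K m n) (d : ℕ)
    (hT : ∀ p, ∀ e ∈ supp (T p), ∃ e' ∈ supp p, ∑ i, e' i ≤ ∑ i, e i + d) :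
    AdicSum (fun i => T (u i)) (T a) := by
  rw [adicSum_iff] at *
  intro N
  obtain ⟨k, hk⟩ := h (N + d)
  refine ⟨k, fun i hi e he => ?_⟩
  rw [← map_sum, ← sub_eq_zero, ← map_sub, ← map_sub]
  by_contra hne
  obtain ⟨e', he', hle⟩ := hT _ e hne
  refine he' ?_
  rw [map_sub, hk i hi e' (by omega), sub_self]

end AdicSum

namespace FormalFamily

variable {K : Type*} [Field K] {m n ρ l : ℕ} (S : FormalFamily K m n ρ l)

/-! ### The partial standard basis -/

theorem G_add (j : Fin l) (a b : Series K m n) : S.G j (a + b) = S.G j a + S.G j b := by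
  simp only [G, mul_add, DiffOp.act_add, Finset.sum_add_distrib]

/-- The operator `G_j` as an additive map. -/
def GHom (j : Fin l) : Series K m n →+ Series K m n := AddMonoidHom.mk' (S.G j) (S.G_add j)

theorem G_zero (j : Fin l) : S.G j 0 = 0 := map_zero (S.GHom j)

theorem F_act (k : Fin ρ) (p : Series K m n) :
    (S.F k).act p = ofX m (special (S.F k 0)) * p - ∑ i, sVar K n i * (S.D i k).act p := by
  conv_lhs => rw [S.F_eq k]
  rw [DiffOp.act_eq_linearCombination, map_sub, map_sum, ← DiffOp.act_eq_linearCombination,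
    DiffOp.act_single_zero]
  simp only [map_smul, smul_eq_mul, DiffOp.act_eq_linearCombination]

/-- Summing F = f - sD against the `j`-th column of `U` collects f U into `g j`; all derivatives
stay behind a factor from s. -/
theorem G_eq (j : Fin l) (t : Series K m n) :
    S.G j t = t * ofX m (S.g j)
      - ∑ i, sVar K n i * ∑ k, (S.D i k).act (t * ofX m (S.U k j)) := by
  have h : ∀ k, (S.F k).act (ofX m (S.U k j) * t) = t * ofX m (special (S.F k 0) * S.U k j)
      - ∑ i, sVar K n i * (S.D i k).act (t * ofX m (S.U k j)) := by
    intro k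
    rw [F_act, ofX_mul, mul_comm _ t, mul_left_comm]
  rw [G, S.g_eq j, ofX_sum, Finset.mul_sum, Finset.sum_congr rfl fun k _ => h k,
    Finset.sum_sub_distrib, Finset.sum_comm]
  simp only [Finset.mul_sum]

theorem reduceStep_eq (r : Series K m n) (j : Fin l) :
    S.reduceStep r j = r - S.G j (S.quot r j) := by
  rw [reduceStep, G_eq]
  ring

theorem exists_lowering_bound_G (j : Fin l) : ∃ d : ℕ, ∀ p, ∀ e ∈ supp (S.G j p),
    ∃ e' ∈ supp p, ∑ i, e' i ≤ ∑ i, e i + d := by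
  -- A crude constant: it only has to dominate the order of every derivative occurring in some `F
  -- k`.
  refine ⟨∑ k, ∑ γ ∈ (S.F k).support, ∑ i, γ i, fun p e he => ?_⟩
  refine (?_ : S.G j p ∈ suppIn K {e : Exp m n | ∃ e' ∈ supp p, ∑ i, e' i ≤
    ∑ i, e i + ∑ k, ∑ γ ∈ (S.F k).support, ∑ i, γ i}) he
  refine sum_mem fun k _ e he => ?_
  obtain ⟨γ, hγ, e', he', hle⟩ := DiffOp.exists_of_mem_supp_act he
  obtain ⟨a, -, b, hb, rfl⟩ := exists_of_mem_supp_mul he'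
  refine ⟨b, hb, ?_⟩
  have h1 : ∑ i, b i ≤ ∑ i, (e + xExp m γ) i :=
    Finset.sum_le_sum fun i _ => (le_add_self.trans hle) i
  have h2 : ∑ i, (e + xExp m γ) i = ∑ i, e i + ∑ i, γ i := by
    rw [sum_exp, sum_exp e]
    simp only [sPart_add, xPart_add, sPart_xExp, xPart_xExp, add_zero, Finsupp.add_apply,
      Finset.sum_add_distrib]
    ring
  have h3 : ∑ i, γ i ≤ ∑ γ ∈ (S.F k).support, ∑ i, γ i :=
    Finset.single_le_sum (f := fun γ : Fin n →₀ ℕ => ∑ i, γ i) (fun _ _ => Nat.zero_le _) hγ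
  have h4 : ∑ γ ∈ (S.F k).support, ∑ i, γ i ≤ ∑ k, ∑ γ ∈ (S.F k).support, ∑ i, γ i :=
    Finset.single_le_sum (f := fun k => ∑ γ ∈ (S.F k).support, ∑ i, γ i)
      (fun _ _ => Nat.zero_le _) (Finset.mem_univ k)
  omega

/-- The quotient shifts the leading exponent of `g j` onto `e`, and multiplicativity of the ordering
keeps the other terms below it. -/
theorem mem_supp_mul_g {j : Fin l} {e e' : Exp m n} {c : K}
    (hj : lexp S.oX.lt (S.g j) ≤ xPart e)
    (he' : e' ∈ supp (MvPowerSeries.monomial (e - xExp m (lexp S.oX.lt (S.g j))) c *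
      ofX m (S.g j))) :
    sPart e' = sPart e ∧ (xPart e' = xPart e ∨ S.oX.lt (xPart e') (xPart e)) := by
  obtain ⟨a, ha, b, hb, rfl⟩ := exists_of_mem_supp_mul he'
  obtain ⟨β, hβ, rfl⟩ := exists_of_mem_supp_ofX hb
  rw [eq_of_mem_supp_monomial ha]
  refine ⟨by simp, ?_⟩
  have h : xPart e = lexp S.oX.lt (S.g j) + (xPart e - lexp S.oX.lt (S.g j)) :=
    (add_tsub_cancel_of_le hj).symm
  simp only [xPart_add, xPart_tsub, xPart_xExp]
  rw [add_comm]
  rcases S.oX.le_lexp hβ with h' | h'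
  · left
    rw [h', ← h]
  · right
    have := S.oX.add_lt_add _ _ (xPart e - lexp S.oX.lt (S.g j)) h'
    rwa [← h] at this

/-- The relation between the exponent `e` of a term and the exponents in `s D (t * u_j)`, where `t`
is the quotient of this term by the leading term of `g_j`. -/
def TailRel (e e' : Exp m n) : Prop :=
  ∃ j i k, ∃ γ ∈ (S.D i k).support, sPart e + Finsupp.single i 1 ≤ sPart e' ∧
    xPart e ≤ xPart e' + γ + lexp S.oX.lt (S.g j)

/-- The factor `s_i` raises the s-part, `∂ ^ γ` removes at most `γ`, and the quotient had lost the
leading exponent of `g j`; all other factors only raise exponents. -/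
theorem mem_supp_tail {j : Fin l} {e e' : Exp m n} {c : K}
    (he' : e' ∈ supp (∑ i, sVar K n i * ∑ k, (S.D i k).act
      (MvPowerSeries.monomial (e - xExp m (lexp S.oX.lt (S.g j))) c * ofX m (S.U k j)))) :
    S.TailRel e e' := by
  refine (?_ : _ ∈ suppIn K {e' | S.TailRel e e'}) he'
  refine sum_mem fun i _ => ?_
  rw [Finset.mul_sum]
  refine sum_mem fun k _ e' he' => ?_
  obtain ⟨a, ha, b, hb, rfl⟩ := exists_of_mem_supp_mul he'
  obtain rfl : a = Finsupp.single (Sum.inl i) 1 := eq_of_mem_supp_monomial ha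
  obtain ⟨γ, hγ, f, hf, hle⟩ := DiffOp.exists_of_mem_supp_act hb
  obtain ⟨a', ha', b', -, rfl⟩ := exists_of_mem_supp_mul hf
  rw [eq_of_mem_supp_monomial ha'] at hle
  have hle' := le_self_add.trans hle
  rw [exp_le_iff] at hle'
  simp only [sPart_add, xPart_add, sPart_tsub, xPart_tsub, sPart_xExp, xPart_xExp, tsub_zero,
    add_zero] at hle'
  refine ⟨j, i, k, γ, hγ, ?_, ?_⟩
  · rw [sPart_add, add_comm]
    refine add_le_add (le_of_eq ?_) hle'.1
    ext i'
    simp [Finsupp.single_apply]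
  · rw [xPart_add]
    refine (tsub_le_iff_right.1 hle'.2).trans ?_
    gcongr
    exact le_add_self

variable {S} in
theorem TailRel.sPart_lt {e e' : Exp m n} (h : S.TailRel e e') :
    S.oS.lt (sPart e') (sPart e) := by
  obtain ⟨_, i, _, _, _, h, -⟩ := h
  refine S.oS.lt_of_le_of_ne (le_self_add.trans h) fun h' => ?_
  have := h i
  rw [← h'] at this
  simp at this

/-- A set of exponents that is closed under the reduction steps. -/
structure StepClosed (A : Set (Exp m n)) : Prop where
  mem_of_xPart : ∀ e ∈ A, ∀ e', sPart e' = sPart e →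
    (xPart e' = xPart e ∨ S.oX.lt (xPart e') (xPart e)) → e' ∈ A
  mem_of_tailRel : ∀ e ∈ A, ∀ e', S.TailRel e e' → e' ∈ A

theorem stepClosed_lowerSupp (p : Series K m n) : S.StepClosed (lowerSupp S.oS S.oX p) where
  mem_of_xPart := by
    rintro e ⟨f, hf, hle⟩ e' hs hx
    refine ⟨f, hf, blockLe_trans ?_ hle⟩
    exact hx.imp (exp_ext hs) fun h => Or.inr ⟨hs, h⟩
  mem_of_tailRel := by
    rintro e ⟨f, hf, hle⟩ e' h
    exact ⟨f, hf, Or.inr (blockLt_of_lt_of_le (Or.inl h.sPart_lt) hle)⟩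

variable {S} in
theorem StepClosed.G_monomial_mem {A : Set (Exp m n)} (hA : S.StepClosed A) {j : Fin l}
    {e : Exp m n} (he : e ∈ A) (hj : lexp S.oX.lt (S.g j) ≤ xPart e) (c : K) :
    S.G j (MvPowerSeries.monomial (e - xExp m (lexp S.oX.lt (S.g j))) c) ∈ suppIn K A := by
  rw [G_eq]
  refine sub_mem (fun e' he' => ?_) (fun e' he' => ?_)
  · have h := S.mem_supp_mul_g hj he'
    exact hA.mem_of_xPart e he e' h.1 h.2
  · exact hA.mem_of_tailRel e he e' (S.mem_supp_tail he')

/-! ### The steps of the normal form algorithm -/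

theorem lexp_mem {p : Series K m n} (hp : p ≠ 0) : lexp S.lt p ∈ supp p := lexp_blockLt_mem hp

theorem le_lexp {p : Series K m n} {e : Exp m n} (he : e ∈ supp p) :
    blockLe S.oS S.oX e (lexp S.lt p) := blockLe_lexp he

theorem mem_supp_sub_lead {r : Series K m n} {e : Exp m n} (he : e ∈ supp (r - lead S.lt r)) :
    e ∈ supp r ∧ S.lt e (lexp S.lt r) := by
  rw [mem_supp, map_sub, lead] at he
  by_cases h : e = lexp S.lt r
  · rw [h, MvPowerSeries.coeff_monomial_same, lcoeff, sub_self] at he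
    exact absurd rfl he
  · rw [MvPowerSeries.coeff_monomial_ne h, sub_zero] at he
    exact ⟨he, (S.le_lexp he).resolve_left h⟩

theorem lead_mem_suppIn {A : Set (Exp m n)} {r : Series K m n} (hr : r ≠ 0)
    (h : r ∈ suppIn K A) : lead S.lt r ∈ suppIn K A :=
  monomial_mem_suppIn (h (S.lexp_mem hr)) _

/-- At the leading exponent the two coefficients cancel, above it nothing occurs, and the tail is
lower already by its s-part. -/
theorem lt_of_mem_supp_reduceStep {r : Series K m n} {j : Fin l}
    (hj : S.Reducible r j) {e : Exp m n} (he : e ∈ supp (S.reduceStep r j)) :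
    S.lt e (lexp S.lt r) := by
  by_contra hlt
  rw [mem_supp, reduceStep, map_add, map_sub] at he
  have htail : MvPowerSeries.coeff e
      (∑ i, sVar K n i * ∑ k, (S.D i k).act (S.quot r j * ofX m (S.U k j))) = 0 := by
    by_contra hne
    exact hlt (Or.inl (S.mem_supp_tail hne).sPart_lt)
  rw [htail, add_zero] at he
  by_cases heq : e = lexp S.lt r
  · refine he ?_
    have h1 : e = e - xExp m (lexp S.oX.lt (S.g j)) + xExp m (lexp S.oX.lt (S.g j)) := by
      rw [tsub_add_cancel_of_le]
      rw [xExp_le_iff, heq]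
      exact hj
    have h2 : MvPowerSeries.coeff e (S.quot r j * ofX m (S.g j)) = MvPowerSeries.coeff e r := by
      have h3 := MvPowerSeries.coeff_add_monomial_mul (e - xExp m (lexp S.oX.lt (S.g j)))
        (xExp m (lexp S.oX.lt (S.g j))) (ofX m (S.g j))
        (lcoeff S.lt r / lcoeff S.oX.lt (S.g j))
      rw [← h1, coeff_xExp_ofX] at h3
      rw [quot, ← heq]
      refine h3.trans ?_
      have hne : lcoeff S.oX.lt (S.g j) ≠ 0 := S.oX.lexp_mem (S.g_ne j)
      rw [lcoeff, ← heq]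
      exact div_mul_cancel₀ _ hne
    rw [h2, sub_self]
  · have h1 : MvPowerSeries.coeff e r = 0 := by
      by_contra hne
      exact hlt ((S.le_lexp hne).resolve_left heq)
    rw [h1, zero_sub, neg_ne_zero] at he
    obtain ⟨hs, hx⟩ := S.mem_supp_mul_g hj he
    rcases hx with hx | hx
    · exact heq (exp_ext hs hx)
    · exact hlt (Or.inr ⟨hs, hx⟩)

theorem coeff_leadS (p : Series K m n) (e : Exp m n) [Decidable (sPart e = S.lexpS p)] :
    MvPowerSeries.coeff e (S.leadS p) =
      if sPart e = S.lexpS p then MvPowerSeries.coeff e p else 0 := by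
  rw [MvPowerSeries.coeff_apply, leadS]
  congr

theorem mem_supp_leadS {p : Series K m n} {e : Exp m n} :
    e ∈ supp (S.leadS p) ↔ e ∈ supp p ∧ sPart e = S.lexpS p := by
  classical
  rw [mem_supp, coeff_leadS]
  split_ifs with h <;> simp [h, mem_supp]

theorem mem_supp_sub_leadS {p : Series K m n} {e : Exp m n} (he : e ∈ supp (p - S.leadS p)) :
    e ∈ supp p ∧ sPart e ≠ S.lexpS p := by
  classical
  rw [mem_supp, map_sub, coeff_leadS] at he
  split_ifs at he with h
  · exact absurd (sub_self _) he
  · exact ⟨by rwa [sub_zero] at he, h⟩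

theorem lexpS_spec {p : Series K m n} (hp : p ≠ 0) : (∃ e ∈ supp p, sPart e = S.lexpS p) ∧
    ∀ e ∈ supp p, sPart e = S.lexpS p ∨ S.oS.lt (sPart e) (S.lexpS p) := by
  have h := maxExp_spec S.oS.wellFounded_gt S.oS.lt_total ((supp_nonempty hp).image sPart)
  exact ⟨h.1, fun e he => h.2 _ ⟨e, he, rfl⟩⟩

theorem splitOff_mem_suppIn (k : ℤ) (p : Series K m n) : S.splitOff k p ∈ suppIn K (supp p) := by
  rw [splitOff]
  split_ifs
  · exact mem_suppIn_supp p
  · exact fun e he => (S.mem_supp_leadS.1 he).1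
  · exact zero_mem _

theorem sub_splitOff_mem {A : Set (Exp m n)} {p : Series K m n} (hp : p ∈ suppIn K A) (k : ℤ) :
    S.splitOff k p ∈ suppIn K A ∧ p - S.splitOff k p ∈ suppIn K A := by
  have h := suppIn_mono hp (S.splitOff_mem_suppIn k p)
  exact ⟨h, sub_mem hp h⟩

/-- The exponents which may occur in the remainder of a computation up to order `k`. -/
def remExp (k : ℤ) : Set (Exp m n) :=
  {e | (-k).toNat ≤ ∑ i, sPart e i ∨ totalDeg S.oS S.oX e < S.N k}

theorem splitOff_mem_remExp (k : ℤ) (p : Series K m n) :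
    S.splitOff k p ∈ suppIn K (S.remExp k) := by
  rw [splitOff]
  split_ifs with h h'
  · exact fun e he => Or.inl ((mem_sIdeal_pow_iff _ _).1 h e he)
  · rcases h' with h' | h'
    · intro e he
      obtain ⟨hep, hes⟩ := S.mem_supp_leadS.1 he
      have hp : p ≠ 0 := by
        rintro rfl
        exact hep (map_zero _)
      -- An exponent of `leadS p` has the s-part of the leading exponent and an x-part at most as
      -- large, so its degree is bounded by the leading one.
      refine Or.inr (lt_of_le_of_lt ?_ h')
      rcases S.le_lexp hep with heq | hlt | ⟨hs, hx⟩
      · rw [heq]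
      · rcases (S.lexpS_spec hp).2 _ (S.lexp_mem hp) with h1 | h1
        · rw [h1, ← hes] at hlt
          exact absurd hlt (S.oS.lt_irrefl _)
        · rw [← hes] at h1
          exact absurd (S.oS.lt_trans _ _ _ hlt h1) (S.oS.lt_irrefl _)
      · rw [totalDeg, totalDeg, hs]
        exact add_le_add le_rfl (S.oX.deg_le_of_lt hx)
    · exact fun e he => Or.inl ((mem_sIdeal_pow_iff _ _).1 h' e he)
  · exact zero_mem _

/-! ### Termination -/

theorem deg_sPart_ge (α : Fin m →₀ ℕ) : S.minDegS * (∑ i, α i : ℕ) ≤ S.oS.deg α := by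
  rw [S.oS.deg_eq_sum, Nat.cast_sum, Finset.mul_sum]
  refine Finset.sum_le_sum fun i _ => ?_
  rw [mul_comm]
  exact mul_le_mul_of_nonneg_left (S.isLeast_minDegS.2 ⟨i, rfl⟩) (Nat.cast_nonneg _)

theorem deg_xPart_ge (β : Fin n →₀ ℕ) : S.minDegX * (∑ i, β i : ℕ) ≤ S.oX.deg β := by
  rw [S.oX.deg_eq_sum, Nat.cast_sum, Finset.mul_sum]
  refine Finset.sum_le_sum fun i _ => ?_
  rw [mul_comm]
  exact mul_le_mul_of_nonneg_left (S.isLeast_minDegX.2 ⟨i, rfl⟩) (Nat.cast_nonneg _)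

theorem minDegS_neg : S.minDegS < 0 := by
  obtain ⟨i, hi⟩ := S.isLeast_minDegS.1
  rw [← hi]
  exact S.oS.deg_neg i

theorem minDegX_neg : S.minDegX < 0 := by
  obtain ⟨i, hi⟩ := S.isLeast_minDegX.1
  rw [← hi]
  exact S.oX.deg_neg i

/-- The exponents in `s` of low order that are at most some exponent of `p`. -/
def sCandidates (k : ℤ) (p : Series K m n) : Set (Fin m →₀ ℕ) :=
  {α | S.minDegS * (-k).toNat ≤ S.oS.deg α ∧ ∃ e ∈ supp p, α = sPart e ∨ S.oS.lt α (sPart e)}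

/-- The exponents of low order that are at most some exponent of `p`. -/
def candidates (k : ℤ) (p : Series K m n) : Set (Exp m n) :=
  {f | (S.minDegS * (-k).toNat ≤ S.oS.deg (sPart f) ∧ S.N k ≤ S.oX.deg (xPart f)) ∧
    f ∈ lowerSupp S.oS S.oX p}

theorem finite_sCandidates (k : ℤ) (p : Series K m n) : (S.sCandidates k p).Finite :=
  (S.oS.finite_deg_ge _).subset fun _ h => h.1

theorem finite_candidates (k : ℤ) (p : Series K m n) : (S.candidates k p).Finite := by
  refine Set.Finite.subset (((S.oS.finite_deg_ge (S.minDegS * (-k).toNat)).prod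
    (S.oX.finite_deg_ge (S.N k))).preimage
      (f := fun e : Exp m n => (sPart e, xPart e)) ?_) fun f hf => hf.1
  intro e _ e' _ h
  exact exp_ext (congrArg Prod.fst h) (congrArg Prod.snd h)

/-- The number of leading exponents that may still occur in the computation of the normal form. -/
def complexity (k : ℤ) (p : Series K m n) : ℕ :=
  (S.sCandidates k p).ncard + (S.candidates k p).ncard

/-- Neither candidate set can grow. Splitting off `leadS p` removes its s-exponent from the first;
splitting off nothing removes the leading exponent from the second. -/
theorem complexity_lt {k : ℤ} {p p' : Series K m n} (h0 : p - S.splitOff k p ≠ 0)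
    (hlt : ∀ e ∈ supp p', S.lt e (lexp S.lt (p - S.splitOff k p))) :
    S.complexity k p' < S.complexity k p := by
  have hmem : lexp S.lt (p - S.splitOff k p) ∈ supp p :=
    (S.sub_splitOff_mem (mem_suppIn_supp p) k).2 (S.lexp_mem h0)
  have hsub1 : S.sCandidates k p' ⊆ S.sCandidates k p := by
    rintro α ⟨hα, e, he, hle⟩
    refine ⟨hα, _, hmem, ?_⟩
    rcases hlt e he with h | ⟨h, -⟩
    · exact Or.inr (hle.elim (fun h' => h' ▸ h) fun h' => S.oS.lt_trans _ _ _ h' h)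
    · rwa [h] at hle
  have hsub2 : S.candidates k p' ⊆ S.candidates k p := by
    rintro f ⟨hf, e, he, hle⟩
    exact ⟨hf, _, hmem, blockLe_trans hle (Or.inr (hlt e he))⟩
  have hle1 := Set.ncard_le_ncard hsub1 (S.finite_sCandidates k p)
  have hle2 := Set.ncard_le_ncard hsub2 (S.finite_candidates k p)
  have hp0 : p ≠ 0 := by
    rintro rfl
    exact hmem (map_zero _)
  unfold splitOff at h0 hlt
  split_ifs at h0 hlt with h h'
  · exact absurd (sub_self p) h0
  all_goals
    rw [mem_sIdeal_pow_iff] at h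
    push Not at h
    obtain ⟨e₀, he₀, hlow⟩ := h
    -- An s-order below `-k` bounds the degree from below, and the larger leading s-exponent
    -- inherits the bound.
    have hdeg : S.minDegS * (-k).toNat ≤ S.oS.deg (sPart e₀) := by
      refine le_trans ?_ (S.deg_sPart_ge _)
      exact mul_le_mul_of_nonpos_left (by exact_mod_cast hlow.le) S.minDegS_neg.le
  · have hspec := S.lexpS_spec hp0
    have h1 : S.lexpS p ∈ S.sCandidates k p := by
      refine ⟨hdeg.trans ?_, ?_⟩
      · rcases hspec.2 e₀ he₀ with h | h
        · rw [h]
        · exact S.oS.deg_le_of_lt h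
      · obtain ⟨e, he, hs⟩ := hspec.1
        exact ⟨e, he, Or.inl hs.symm⟩
    have h2 : S.lexpS p ∉ S.sCandidates k p' := by
      rintro ⟨-, e, he, hle⟩
      obtain ⟨hl, hne⟩ := S.mem_supp_sub_leadS (S.lexp_mem h0)
      have h3 := (hspec.2 _ hl).resolve_left hne
      have h4 : S.oS.lt (sPart e) (S.lexpS p) := by
        rcases hlt e he with h | ⟨h, -⟩
        · exact S.oS.lt_trans _ _ _ h h3
        · rwa [h]
      rcases hle with h | h
      · rw [← h] at h4
        exact S.oS.lt_irrefl _ h4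
      · exact S.oS.lt_irrefl _ (S.oS.lt_trans _ _ _ h h4)
    have := Set.ncard_lt_ncard ⟨hsub1, fun h => h2 (h h1)⟩ (S.finite_sCandidates k p)
    unfold complexity
    omega
  · rw [sub_zero] at hlt
    push Not at h'
    have h1 : lexp S.lt p ∈ S.candidates k p := by
      refine ⟨⟨hdeg.trans ?_, ?_⟩, _, S.lexp_mem hp0, Or.inl rfl⟩
      · rcases S.le_lexp he₀ with h | h | ⟨h, -⟩
        · rw [h]
        · exact S.oS.deg_le_of_lt h
        · rw [h]
      -- The total degree is at least `N k` and the s-degree is nonpositive, so the x-degree alone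
      -- is at least `N k`.
      · refine h'.1.trans ?_
        rw [totalDeg]
        linarith [S.oS.deg_nonpos (sPart (lexp S.lt p))]
    have h2 : lexp S.lt p ∉ S.candidates k p' := by
      rintro ⟨-, e, he, hle⟩
      exact blockLt_irrefl _ _ _ (blockLt_of_lt_of_le (hlt e he) hle)
    have := Set.ncard_lt_ncard ⟨hsub2, fun h => h2 (h h1)⟩ (S.finite_candidates k p)
    unfold complexity
    omega

/-- The normal form algorithm terminates. -/
theorem exists_NF (k : ℤ) (p : Series K m n) : ∃ r a q, S.NF k p r a q := by
  induction hN : S.complexity k p using Nat.strong_induction_on generalizing p with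
  | _ N ih =>
    subst hN
    by_cases h0 : p - S.splitOff k p = 0
    · exact ⟨_, _, _, NF.done p h0⟩
    by_cases hred : ∃ j, S.Reducible (p - S.splitOff k p) j
    · obtain ⟨j, hj, hmin⟩ := wellFounded_lt.has_min {j | S.Reducible (p - S.splitOff k p) j} hred
      obtain ⟨r, a, q, h⟩ := ih _ (S.complexity_lt h0 fun e he =>
        S.lt_of_mem_supp_reduceStep hj he) _ rfl
      exact ⟨_, _, _, NF.reduce p h0 j hj (fun i hi => not_lt.1 (hmin i hi)) r a q h⟩
    · obtain ⟨r, a, q, h⟩ := ih _ (S.complexity_lt h0 fun e he =>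
        (S.mem_supp_sub_lead he).2) _ rfl
      exact ⟨_, _, _, NF.keep p h0 (not_exists.1 hred) r a q h⟩

end FormalFamily

namespace FormalFamily

variable {K : Type*} [Field K] {m n ρ l : ℕ} {S : FormalFamily K m n ρ l}

/-! ### Properties of the normal form with respect to one order -/

/-- The normal form algorithm is deterministic. -/
theorem NF.unique {k : ℤ} {p r q r' q' : Series K m n} {a a' : Fin l → Series K m n}
    (h : S.NF k p r a q) (h' : S.NF k p r' a' q') : r = r' ∧ a = a' ∧ q = q' := by
  induction h generalizing r' a' q' with
  | done p h =>
    cases h' with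
    | done _ => exact ⟨rfl, rfl, rfl⟩
    | reduce _ h' => exact absurd h h'
    | keep _ h' => exact absurd h h'
  | reduce p h j hj hmin r a q _ ih =>
    cases h' with
    | done _ h' => exact absurd h' h
    | reduce _ _ j' hj' hmin' r' a' q' call' =>
      obtain rfl : j = j' := le_antisymm (hmin _ hj') (hmin' _ hj)
      obtain ⟨rfl, rfl, rfl⟩ := ih call'
      exact ⟨rfl, rfl, rfl⟩
    | keep _ _ hj' => exact absurd hj (hj' j)
  | keep p h hj r a q _ ih =>
    cases h' with
    | done _ h' => exact absurd h' h
    | reduce _ _ j' hj' => exact absurd hj' (hj j')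
    | keep _ _ _ r' a' q' call' =>
      obtain ⟨rfl, rfl, rfl⟩ := ih call'
      exact ⟨rfl, rfl, rfl⟩

theorem NF.eq {k : ℤ} {p r q : Series K m n} {a : Fin l → Series K m n}
    (h : S.NF k p r a q) : p = (∑ j, S.G j (a j) + r) + q := by
  induction h with
  | done p h => simpa [G_zero] using sub_eq_zero.1 h
  | reduce p h j hj hmin r a q _ ih =>
    rw [reduceStep_eq] at ih
    have h1 : ∑ i, S.G i ((a + Pi.single j (S.quot (p - S.splitOff k p) j) : Fin l → Series K m n) i) =
        ∑ i, S.G i (a i) + S.G j (S.quot (p - S.splitOff k p) j) := by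
      simp only [Pi.add_apply, G_add, Finset.sum_add_distrib]
      congr 1
      rw [Finset.sum_eq_single j, Pi.single_eq_same]
      · intro i _ hi
        rw [Pi.single_eq_of_ne hi, G_zero]
      · exact fun h => absurd (Finset.mem_univ j) h
    rw [h1]
    linear_combination ih
  | keep p h hj r a q _ ih => linear_combination ih

/-- The bound on `a j` itself is what makes the quotients converge; adding the leading exponent of
`g j` undoes the division. -/
theorem NF.mem_suppIn {A : Set (Exp m n)} (hA : S.StepClosed A) {k : ℤ} {p r q : Series K m n}
    {a : Fin l → Series K m n} (h : S.NF k p r a q) (hp : p ∈ suppIn K A) :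
    r ∈ suppIn K A ∧ q ∈ suppIn K A ∧ ∀ j, S.G j (a j) ∈ suppIn K A ∧
      a j ∈ suppIn K {e | e + xExp m (lexp S.oX.lt (S.g j)) ∈ A} := by
  induction h with
  | done p h =>
    refine ⟨zero_mem _, (S.sub_splitOff_mem hp k).1, fun j => ⟨?_, zero_mem _⟩⟩
    rw [Pi.zero_apply, G_zero]
    exact zero_mem _
  | reduce p h j hj hmin r a q _ ih =>
    obtain ⟨hq, hr⟩ := S.sub_splitOff_mem hp k
    have hlead := hr (S.lexp_mem h)
    have hG : S.G j (S.quot (p - S.splitOff k p) j) ∈ suppIn K A := hA.G_monomial_mem hlead hj _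
    obtain ⟨h1, h2, h3⟩ := ih (by rw [reduceStep_eq]; exact sub_mem hr hG)
    refine ⟨h1, add_mem hq h2, fun i => ?_⟩
    rw [Pi.add_apply, G_add]
    by_cases hi : i = j
    · subst hi
      rw [Pi.single_eq_same]
      refine ⟨add_mem (h3 i).1 hG, add_mem (h3 i).2 (monomial_mem_suppIn ?_ _)⟩
      show _ - xExp m _ + xExp m _ ∈ A
      rwa [tsub_add_cancel_of_le (xExp_le_iff.2 hj)]
    · rw [Pi.single_eq_of_ne hi, G_zero, add_zero, add_zero]
      exact h3 i
  | keep p h hj r a q _ ih =>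
    obtain ⟨hq, hr⟩ := S.sub_splitOff_mem hp k
    have hl := S.lead_mem_suppIn h hr
    obtain ⟨h1, h2, h3⟩ := ih (sub_mem hr hl)
    exact ⟨add_mem hl h1, add_mem hq h2, h3⟩

theorem NF.mem_remExp {k : ℤ} {p r q : Series K m n} {a : Fin l → Series K m n}
    (h : S.NF k p r a q) : q ∈ suppIn K (S.remExp k) := by
  induction h with
  | done p h => exact S.splitOff_mem_remExp k p
  | reduce p h j hj hmin r a q _ ih => exact add_mem (S.splitOff_mem_remExp k p) ih
  | keep p h hj r a q _ ih => exact add_mem (S.splitOff_mem_remExp k p) ih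

theorem NF.mem_basisExp {k : ℤ} {p r q : Series K m n} {a : Fin l → Series K m n}
    (h : S.NF k p r a q) : r ∈ suppIn K {e : Exp m n | xPart e ∈ S.basisExp} := by
  induction h with
  | done p h => exact zero_mem _
  | reduce p h j hj hmin r a q _ ih => exact ih
  | keep p h hj r a q _ ih => exact add_mem (monomial_mem_suppIn (A := {e : Exp m n | xPart e ∈ S.basisExp}) hj _) ih

theorem NF.eq_zero_of_mem_basisExp {k : ℤ} {p r q : Series K m n} {a : Fin l → Series K m n}
    (h : S.NF k p r a q) (hp : p ∈ suppIn K {e : Exp m n | xPart e ∈ S.basisExp}) :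
    a = 0 ∧ q ∈ suppIn K {e : Exp m n | xPart e ∈ S.basisExp} := by
  induction h with
  | done p h => exact ⟨rfl, (S.sub_splitOff_mem hp k).1⟩
  | reduce p h j hj hmin r a q _ ih =>
    exact absurd hj ((S.sub_splitOff_mem hp k).2 (S.lexp_mem h) j)
  | keep p h hj r a q _ ih =>
    obtain ⟨hq, hr⟩ := S.sub_splitOff_mem hp k
    obtain ⟨h1, h2⟩ := ih (sub_mem hr (S.lead_mem_suppIn h hr))
    exact ⟨h1, add_mem hq h2⟩

/-! ### A weight which the reduction steps do not decrease -/

variable (S) in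
-- Only finitely many derivatives and `g j` occur, so one `C` outweighs every loss. The bound
-- `-S.minDegS ≤ C` makes the weight at least minus the total degree.
theorem exists_weight_factor : ∃ C : ℚ, -S.minDegS ≤ C ∧
    ∀ j i k, ∀ γ ∈ (S.D i k).support, -S.oX.deg γ - S.oX.deg (lexp S.oX.lt (S.g j)) ≤ C := by
  have hfin : (⋃ j, ⋃ i, ⋃ k, (fun γ => -S.oX.deg γ - S.oX.deg (lexp S.oX.lt (S.g j))) ''
      ((S.D i k).support : Set (Fin n →₀ ℕ))).Finite :=
    Set.finite_iUnion fun _ => Set.finite_iUnion fun _ => Set.finite_iUnion fun _ =>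
      (Finset.finite_toSet _).image _
  obtain ⟨C, hC⟩ := hfin.bddAbove
  refine ⟨max (-S.minDegS) C, le_max_left _ _, fun j i k γ hγ => le_max_of_le_right (hC ?_)⟩
  simp only [Set.mem_iUnion]
  exact ⟨j, i, k, γ, hγ, rfl⟩

variable (S) in
/-- The weight of an exponent, where every variable `s_j` has weight `C`. -/
def weight (C : ℚ) (e : Exp m n) : ℚ := C * (∑ i, sPart e i : ℕ) - S.oX.deg (xPart e)

theorem stepClosed_weight {C : ℚ} (hC0 : 0 ≤ C) (hC : ∀ j i k, ∀ γ ∈ (S.D i k).support,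
    -S.oX.deg γ - S.oX.deg (lexp S.oX.lt (S.g j)) ≤ C) (c : ℚ) :
    S.StepClosed {e | c ≤ S.weight C e} where
  mem_of_xPart := by
    intro e he e' hs hx
    refine le_trans (Set.mem_ofPred_eq ▸ he) ?_
    rw [weight, weight, hs]
    rcases hx with h | h
    · rw [h]
    · linarith [S.oX.deg_le_of_lt h]
  mem_of_tailRel := by
    rintro e he e' ⟨j, i, k, γ, hγ, hs, hx⟩
    have h1 := S.oX.deg_anti hx
    rw [map_add, map_add] at h1
    have h2 : ∑ i, sPart e i + 1 ≤ ∑ i, sPart e' i := by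
      refine le_trans (le_of_eq ?_) (Finset.sum_le_sum fun i _ => hs i)
      simp [Finset.sum_add_distrib, Finsupp.single_apply]
    have h3 : ((∑ i, sPart e i : ℕ) : ℚ) + 1 ≤ (∑ i, sPart e' i : ℕ) := by exact_mod_cast h2
    have h4 := mul_le_mul_of_nonneg_left h3 hC0
    have h5 := hC j i k γ hγ
    rw [Set.mem_ofPred_eq, weight] at *
    linarith

/-- Converts weight estimates into adic ones: large weight forces large total order. -/
theorem weight_le {C : ℚ} (e : Exp m n) :
    S.weight C e ≤ max C (-S.minDegX) * (∑ i, e i : ℕ) := by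
  have h1 := S.deg_xPart_ge (xPart e)
  have h2 := mul_le_mul_of_nonneg_right (le_max_left C (-S.minDegX))
    (Nat.cast_nonneg (α := ℚ) (∑ i, sPart e i))
  have h3 := mul_le_mul_of_nonneg_right (le_max_right C (-S.minDegX))
    (Nat.cast_nonneg (α := ℚ) (∑ i, xPart e i))
  rw [weight, sum_exp, Nat.cast_add, mul_add]
  linarith

/-- Either the s-order is at least `-k`, or the total degree is below `N k` and the weight exceeds
`-N k`; the absolute value serves both cases. -/
theorem le_weight_of_mem_remExp {C : ℚ} (hC : -S.minDegS ≤ C) {k : ℤ} (hk : k ≤ 0) {e : Exp m n}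
    (he : e ∈ S.remExp k) :
    -S.minDegS * (-k : ℤ) - |S.maxDegD - S.minDegX| ≤ S.weight C e := by
  have h0 : 0 ≤ -S.minDegS := neg_nonneg.2 S.minDegS_neg.le
  have habs := le_abs_self (S.maxDegD - S.minDegX)
  have habs' := abs_nonneg (S.maxDegD - S.minDegX)
  have hx := S.oX.deg_nonpos (xPart e)
  have h1 : -S.minDegS * (∑ i, sPart e i : ℕ) ≤ C * (∑ i, sPart e i : ℕ) :=
    mul_le_mul_of_nonneg_right hC (Nat.cast_nonneg _)
  rw [weight]
  rcases he with h | h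
  · have h2 : (-k : ℤ) ≤ (∑ i, sPart e i : ℕ) := by omega
    have h3 : ((-k : ℤ) : ℚ) ≤ (∑ i, sPart e i : ℕ) := by exact_mod_cast h2
    have h4 := mul_le_mul_of_nonneg_left h3 h0
    linarith
  · rw [totalDeg, N] at h
    have h2 := S.deg_sPart_ge (sPart e)
    push_cast at *
    linarith

/-- Series of increasing weight tend to zero. -/
theorem eventually_coeff_eq_zero {C b c : ℚ} (hb : 0 < b) {u : ℕ → Series K m n}
    (hu : ∀ i : ℕ, u (i + 1) ∈ suppIn K {e | b * (i : ℕ) - c ≤ S.weight C e}) (N : ℕ) :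
    ∃ k₀, ∀ i ≥ k₀, ∀ e : Exp m n, ∑ i, e i < N → MvPowerSeries.coeff e (u i) = 0 := by
  obtain ⟨k, hk⟩ := exists_nat_gt ((max C (-S.minDegX) * N + c) / b)
  rw [div_lt_iff₀ hb] at hk
  -- Nothing is assumed about `u 0`, hence the shift by one.
  refine ⟨k + 1, fun i hi e he => coeff_eq_zero_of_mem_suppIn
    (A := {e | b * (i - 1 : ℕ) - c ≤ S.weight C e}) ?_ ?_⟩
  · have := hu (i - 1)
    rwa [Nat.sub_add_cancel (by omega)] at this
  · rw [Set.mem_ofPred_eq, not_le]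
    have h1 : (k : ℚ) ≤ (i - 1 : ℕ) := by
      have : k ≤ i - 1 := by omega
      exact_mod_cast this
    have h2 := mul_le_mul_of_nonneg_left h1 hb.le
    have h3 : (0 : ℚ) ≤ max C (-S.minDegX) := le_max_of_le_right (neg_nonneg.2 S.minDegX_neg.le)
    have h4 : ((∑ i, e i : ℕ) : ℚ) ≤ N := by exact_mod_cast he.le
    have h5 := mul_le_mul_of_nonneg_left h4 h3
    linarith [S.weight_le (C := C) e]

/-! ### The span of the monomials outside the leading ideal -/

variable (S) in
-- Monomials of order at least `k` lie in the ideal, so a leading exponent of the standard basis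
-- divides them.
theorem finite_basisExp : S.basisExp.Finite := by
  obtain ⟨k, hk⟩ := S.finite_f
  have hsub : S.basisExp ⊆ {β | ∑ i, β i < k} := by
    intro β hβ
    by_contra hlt
    rw [Set.mem_ofPred_eq, not_lt] at hlt
    have hmem : MvPowerSeries.monomial β (1 : K) ∈
        Ideal.span (Set.range (MvPowerSeries.X : Fin n → MvPowerSeries (Fin n) K)) ^ k :=
      (mem_span_X_pow_iff (fun i : Fin n => i) Function.injective_id k _).2 fun e he =>
        eq_of_mem_supp_monomial he ▸ hlt
    have hne : MvPowerSeries.monomial β (1 : K) ≠ 0 := by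
      intro h
      have := congrArg (MvPowerSeries.coeff β) h
      simp at this
    obtain ⟨i, hi⟩ := S.g_std _ (hk hmem) hne
    rw [eq_of_mem_supp_monomial (S.oX.lexp_mem hne)] at hi
    exact hβ i hi
  refine (S.oX.finite_deg_ge (S.minDegX * k)).subset fun β hβ => ?_
  refine le_trans ?_ (S.deg_xPart_ge β)
  have h : ((∑ i, β i : ℕ) : ℚ) ≤ k := by exact_mod_cast (hsub hβ).le
  exact mul_le_mul_of_nonpos_left h S.minDegX_neg.le

theorem coeff_ofS_mul_ofX_monomial (f : MvPowerSeries (Fin m) K) (β : Fin n →₀ ℕ) (e : Exp m n)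
    [Decidable (xPart e = β)] :
    MvPowerSeries.coeff e (ofS n f * ofX m (MvPowerSeries.monomial β 1)) =
      if xPart e = β then MvPowerSeries.coeff (sPart e) f else 0 := by
  split_ifs with h
  · have he : e = sExp n (sPart e) + xExp m β := exp_ext (by simp) (by simp [h])
    rw [ofX_monomial]
    conv_lhs => rw [he]
    rw [MvPowerSeries.coeff_add_mul_monomial, coeff_sExp_ofS, mul_one]
  · by_contra hne
    obtain ⟨a, ha, b, hb, rfl⟩ := exists_of_mem_supp_mul hne
    obtain ⟨α, -, rfl⟩ := exists_of_mem_supp_ofS ha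
    rw [ofX_monomial] at hb
    rw [eq_of_mem_supp_monomial hb] at h
    simp at h

/-- Since the family of monomials is finite, no finiteness has to be imposed on the coefficients and
the span is a pure support condition. -/
theorem inBasisSpan_iff {r : Series K m n} :
    S.InBasisSpan r ↔ r ∈ suppIn K {e : Exp m n | xPart e ∈ S.basisExp} := by
  classical
  constructor
  · rintro ⟨c, hc, rfl⟩
    refine sum_mem fun β hβ e he => ?_
    rw [mem_supp, coeff_ofS_mul_ofX_monomial] at he
    split_ifs at he with h
    · rw [Set.mem_ofPred_eq, h]
      exact hc β hβ
    · exact absurd rfl he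
  · intro hr
    let c : (Fin n →₀ ℕ) → MvPowerSeries (Fin m) K := fun β α =>
      MvPowerSeries.coeff (sExp n α + xExp m β) r
    have hc : ∀ β α, MvPowerSeries.coeff α (c β) =
      MvPowerSeries.coeff (sExp n α + xExp m β) r := fun _ _ => rfl
    have hmem : ∀ β, c β ≠ 0 → β ∈ S.basisExp := by
      intro β hβ
      obtain ⟨α, hα⟩ := supp_nonempty hβ
      have := hr hα
      simpa using this
    refine ⟨Finsupp.onFinset S.finite_basisExp.toFinset c fun β hβ =>
      S.finite_basisExp.mem_toFinset.2 (hmem β hβ), fun β hβ => hmem β (by simpa using hβ), ?_⟩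
    ext e
    rw [Finsupp.onFinset_sum, map_sum]
    · simp only [coeff_ofS_mul_ofX_monomial]
      rw [Finset.sum_ite_eq]
      have he : sExp n (sPart e) + xExp m (xPart e) = e := exp_ext (by simp) (by simp)
      rw [hc, he]
      split_ifs with h
      · rfl
      · refine coeff_eq_zero_of_mem_suppIn hr fun h' => h ?_
        exact S.finite_basisExp.mem_toFinset.2 h'
    · intro β
      rw [ofS, map_zero, zero_mul]

/-! ### The limit normal form -/

section Limit

variable {κ : ℕ → ℤ} {P R : ℕ → Series K m n} {A : ℕ → Fin l → Series K m n}

theorem mem_suppIn_of_NF {B : Set (Exp m n)} (hB : S.StepClosed B) (h0 : P 0 ∈ suppIn K B)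
    (h : ∀ i, S.NF (κ i) (P i) (R i) (A i) (P (i + 1))) (i : ℕ) : P i ∈ suppIn K B := by
  induction i with
  | zero => exact h0
  | succ i ih => exact ((h i).mem_suppIn hB ih).2.1

/-- `P (i + 1)` is the remainder of order `κ i`, and the next computation passes its weight bound on
to `R (i + 1)` and `A (i + 1)`; the input `P 0` has no such bound. -/
theorem exists_weight_bounds (hanti : StrictAnti κ) (hκ : ∀ i, κ i ≤ 0)
    (h : ∀ i, S.NF (κ i) (P i) (R i) (A i) (P (i + 1))) :
    ∃ C b c : ℚ, 0 < b ∧ ∀ i : ℕ, P (i + 1) ∈ suppIn K {e | b * (i : ℕ) - c ≤ S.weight C e} ∧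
      R (i + 1) ∈ suppIn K {e | b * (i : ℕ) - c ≤ S.weight C e} ∧
      ∀ j, A (i + 1) j ∈ suppIn K
        {e | b * (i : ℕ) - (c - S.oX.deg (lexp S.oX.lt (S.g j))) ≤ S.weight C e} := by
  obtain ⟨C, hC, hC'⟩ := S.exists_weight_factor
  have hb := neg_pos.2 S.minDegS_neg
  refine ⟨C, -S.minDegS, |S.maxDegD - S.minDegX|, hb, fun i => ?_⟩
  -- A strictly decreasing sequence of nonpositive integers drops at least as fast as `-i`.
  have hi : ∀ i : ℕ, (i : ℤ) ≤ -κ i := by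
    intro i
    induction i with
    | zero => simpa using hκ 0
    | succ i ih =>
      have := hanti (Nat.lt_add_one i)
      push_cast
      omega
  have hP : P (i + 1) ∈ suppIn K
      {e | -S.minDegS * (i : ℕ) - |S.maxDegD - S.minDegX| ≤ S.weight C e} := by
    intro e he
    refine le_trans ?_ (S.le_weight_of_mem_remExp hC (hκ i) ((h i).mem_remExp he))
    have h1 : (i : ℚ) ≤ (-κ i : ℤ) := by exact_mod_cast hi i
    linarith [mul_le_mul_of_nonneg_left h1 hb.le]
  obtain ⟨hR, -, hA⟩ := (h (i + 1)).mem_suppIn (stepClosed_weight (hb.le.trans hC) hC' _) hP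
  refine ⟨hP, hR, fun j e he => ?_⟩
  have := (hA j).2 he
  simp only [Set.mem_ofPred_eq, weight, sPart_add, xPart_add, sPart_xExp, xPart_xExp, add_zero,
    map_add] at this ⊢
  linarith

theorem eq_sum_add (h : ∀ i, S.NF (κ i) (P i) (R i) (A i) (P (i + 1))) (k : ℕ) :
    P 0 = ∑ i ∈ Finset.range k, (∑ j, S.G j (A i j) + R i) + P k := by
  induction k with
  | zero => simp
  | succ k ih =>
    rw [Finset.sum_range_succ, add_assoc, ← (h k).eq]
    exact ih

theorem adicSum_G {u : ℕ → Series K m n} {a : Series K m n} (h : AdicSum u a) (j : Fin l) :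
    AdicSum (fun i => S.G j (u i)) (S.G j a) := by
  obtain ⟨d, hd⟩ := S.exists_lowering_bound_G j
  exact h.map (S.GHom j) d hd

/-- The partial sums telescope to `P 0 - P k`, and the remainders tend to zero. -/
theorem adicSum_of_NF (hanti : StrictAnti κ) (hκ : ∀ i, κ i ≤ 0)
    (h : ∀ i, S.NF (κ i) (P i) (R i) (A i) (P (i + 1))) :
    AdicSum (fun i => ∑ j, S.G j (A i j) + R i) (P 0) := by
  obtain ⟨C, b, c, hb, hbd⟩ := exists_weight_bounds hanti hκ h
  rw [adicSum_iff]
  intro N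
  obtain ⟨k, hk⟩ := eventually_coeff_eq_zero hb (fun i => (hbd i).1) N
  refine ⟨k, fun i hi e he => ?_⟩
  rw [eq_sum_add h i, map_add, hk i hi e he, add_zero]

end Limit

variable {κ : ℕ → ℤ} {p r : Series K m n} {a : Fin l → Series K m n}

variable (S) in
theorem exists_isLimitNF (hanti : StrictAnti κ) (hκ : ∀ i, κ i ≤ 0) (p : Series K m n) :
    ∃ r a, S.IsLimitNF κ p r a := by
  choose r a q hNF using S.exists_NF
  let P : ℕ → Series K m n := fun i => Nat.rec p (fun i p' => q (κ i) p') i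
  have h : ∀ i, S.NF (κ i) (P i) (r (κ i) (P i)) (a (κ i) (P i)) (P (i + 1)) :=
    fun i => hNF (κ i) (P i)
  obtain ⟨C, b, c, hb, hbd⟩ := exists_weight_bounds hanti hκ h
  obtain ⟨r', hr'⟩ := exists_adicSum (u := fun i => r (κ i) (P i))
    (eventually_coeff_eq_zero hb fun i => (hbd i).2.1)
  choose a' ha' using fun j => exists_adicSum (u := fun i => a (κ i) (P i) j)
    (eventually_coeff_eq_zero hb fun i => (hbd i).2.2 j)
  exact ⟨r', a', P, _, _, rfl, h, hr', ha'⟩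

theorem IsLimitNF.unique {r' : Series K m n} {a' : Fin l → Series K m n}
    (h : S.IsLimitNF κ p r a) (h' : S.IsLimitNF κ p r' a') : r = r' ∧ a = a' := by
  obtain ⟨P, R, A, h0, hNF, hr, ha⟩ := h
  obtain ⟨P', R', A', h0', hNF', hr', ha'⟩ := h'
  have hP : ∀ i, P i = P' i := by
    intro i
    induction i with
    | zero => rw [h0, h0']
    | succ i ih =>
      have := hNF i
      rw [ih] at this
      exact (this.unique (hNF' i)).2.2
  obtain rfl : P = P' := funext hP
  obtain rfl : R = R' := funext fun i => ((hNF i).unique (hNF' i)).1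
  obtain rfl : A = A' := funext fun i => ((hNF i).unique (hNF' i)).2.1
  exact ⟨hr.unique hr', funext fun j => (ha j).unique (ha' j)⟩

theorem IsLimitNF.eq (hanti : StrictAnti κ) (hκ : ∀ i, κ i ≤ 0) (h : S.IsLimitNF κ p r a) :
    p = ∑ i, S.G i (a i) + r := by
  obtain ⟨P, R, A, rfl, hNF, hr, ha⟩ := h
  exact (adicSum_of_NF hanti hκ hNF).unique
    ((AdicSum.finsetSum Finset.univ fun j => adicSum_G (ha j) j).add hr)

theorem IsLimitNF.mem_lowerSupp (h : S.IsLimitNF κ p r a) :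
    r ∈ suppIn K (lowerSupp S.oS S.oX p) ∧
      ∀ i, S.G i (a i) ∈ suppIn K (lowerSupp S.oS S.oX p) := by
  obtain ⟨P, R, A, rfl, hNF, hr, ha⟩ := h
  have hcl := S.stepClosed_lowerSupp (P 0)
  have hP := mem_suppIn_of_NF hcl (fun e he => ⟨e, he, Or.inl rfl⟩) hNF
  exact ⟨hr.mem_suppIn fun i => ((hNF i).mem_suppIn hcl (hP i)).1, fun j =>
    (adicSum_G (ha j) j).mem_suppIn fun i => (((hNF i).mem_suppIn hcl (hP i)).2.2 j).1⟩

theorem IsLimitNF.inBasisSpan (h : S.IsLimitNF κ p r a) : S.InBasisSpan r := by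
  obtain ⟨P, R, A, rfl, hNF, hr, ha⟩ := h
  exact inBasisSpan_iff.2 (hr.mem_suppIn fun i => (hNF i).mem_basisExp)

theorem IsLimitNF.eq_zero_of_inBasisSpan (h : S.IsLimitNF κ p r a) (hp : S.InBasisSpan p) :
    a = 0 := by
  obtain ⟨P, R, A, rfl, hNF, hr, ha⟩ := h
  have hP : ∀ i, P i ∈ suppIn K {e : Exp m n | xPart e ∈ S.basisExp} := by
    intro i
    induction i with
    | zero => exact inBasisSpan_iff.1 hp
    | succ i ih => exact ((hNF i).eq_zero_of_mem_basisExp ih).2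
  have hA : ∀ i, A i = 0 := fun i => ((hNF i).eq_zero_of_mem_basisExp (hP i)).1
  funext j
  refine (ha j).unique ?_
  simp only [hA]
  exact AdicSum.zero

end FormalFamily

end PartialSB

end

theorem mainTheorem6 {K : Type*} [Field K] {m n ρ l : ℕ}
    (S : PartialSB.FormalFamily K m n ρ l)
    (κ : ℕ → ℤ) (hκ_anti : StrictAnti κ) (hκ_nonpos : ∀ i, κ i ≤ 0)
    (p : PartialSB.Series K m n) :
    (∃! z : PartialSB.Series K m n × (Fin l → PartialSB.Series K m n),
      S.IsLimitNF κ p z.1 z.2) ∧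
    ∀ (r : PartialSB.Series K m n) (a : Fin l → PartialSB.Series K m n), S.IsLimitNF κ p r a →
      p = ∑ i, S.G i (a i) + r ∧
      (∀ i, PartialSB.LeadLE S.lt (S.G i (a i)) p) ∧
      (S.InBasisSpan r ∧ PartialSB.LeadLE S.lt r p) ∧
      (S.InBasisSpan p → r = p ∧ a = 0) := by
  refine ⟨?_, fun r a h => ?_⟩
  · obtain ⟨r, a, h⟩ := S.exists_isLimitNF hκ_anti hκ_nonpos p
    refine ⟨(r, a), h, fun z hz => ?_⟩
    exact Prod.ext_iff.2 (hz.unique h)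
  · have heq := h.eq hκ_anti hκ_nonpos
    obtain ⟨hr, hG⟩ := h.mem_lowerSupp
    refine ⟨heq, fun i => PartialSB.leadLE_of_mem_suppIn (hG i),
      ⟨h.inBasisSpan, PartialSB.leadLE_of_mem_suppIn hr⟩, fun hp => ?_⟩
    have ha := h.eq_zero_of_inBasisSpan hp
    subst ha
    refine ⟨?_, rfl⟩
    -- With vanishing quotients the identity p = G a + r collapses to p = r.
    rw [heq]
    simp [PartialSB.FormalFamily.G_zero]
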